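/- Let $0$-$\mathrm{Gph}=\mathrm{Set}$ and, for a category $\mathcal V$, let $\mathcal V$-$\mathrm{Gph}$ be the category of $\mathcal V$-graphs: a $\mathcal V$-graph is a set $A_0$ of objects with an object $A(a,a')\in\mathcal V$ for all $a,a'\in A_0$, and a morphism is a function $F$ on objects with morphisms $A(a,a')\to B(Fa,Fa')$. Put $(n+1)$-$\mathrm{Gph}=(n\text{-}\mathrm{Gph})$-$\mathrm{Gph}$; this category has finite products. For $0\le i<n$ define the category $[(n-i-1)\text{-}\mathrm{Gph}]\text{-}\mathrm{Cat}\text{-}[i\text{-}\mathrm{Gph}]$ together with a forgetful functor $U$ to $n$-$\mathrm{Gph}$ as follows. For $i=0$ it is the category of small categories enriched in $(n-1)$-$\mathrm{Gph}$ (with its cartesian product), and $U$ is the functor that forgets composition and identities. For $i>0$ it is the category of graphs enriched in $[(n-i-1)\text{-}\mathrm{Gph}]\text{-}\mathrm{Cat}\text{-}[(i-1)\text{-}\mathrm{Gph}]$, and $U$ applies the forgetful functor to $(n-1)$-$\mathrm{Gph}$ to every $A(a,a')$. An $n$-globular set is a diagram of sets $A(n)\rightrightarrows A(n-1)\rightrightarrows\cdots\rightrightarrows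 A(0)$ with source and target maps $s,t$ such that $ss=st$ and $ts=tt$. The cells of an $n$-graph form an $n$-globular set: for $n=0$ the $0$-cells are the elements of the set; for $n\ge 1$ the $0$-cells are the objects, and the $(m+1)$-cells are the $m$-cells of all the $A(a,a')$. For an $n$-graph $A$ write $A(m)$ for its set of $m$-cells. **Proposition.** Let $n\ge 1$ and $0\le i\le n-1$. 1. Taking cells is an equivalence between $n$-$\mathrm{Gph}$ and the category of $n$-globular sets. 2. The forgetful functor $U:[(n-i-1)\text{-}\mathrm{Gph}]\text{-}\mathrm{Cat}\text{-}[i\text{-}\mathrm{Gph}]\to n\text{-}\mathrm{Gph}$ has a left adjoint, and the adjunction is monadic: the comparison functor to the category of algebras of the induced monad $T^{(n)}_i$ is an equivalence. 3. There are bijections, natural in the $n$-graph $A$, $$ (T^{(n)}_iA)(m)\;\cong\;\begin{cases} A(m) & m\le i,\\[1ex] \displaystyle\coprod_{k\ge 0}\ \underbrace{A(m)\times_{A(i)}\cdots\times_{A(i)}A(m)}_{k\text{ times}} & m>i.\end{cases}$$ Here the $k$-fold wide pullback is taken along the iterated target and source maps $t,s:A(m)\to A(i)$, so that its elements are the strings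 of $k$ $m$-cells in which the target $i$-cell of each is the source $i$-cell of the next; for $k=0$ it is $A(i)$. These bijections respect sources and targets, where the source and target of a string of $m$-cells are taken cell by cell if $m>i+1$, and are the first and the last $i$-cell of the string if $m=i+1$ (for $k=0$, the $i$-cell itself, and for $m>i+1$ the source and target of the string of length $0$ on an $i$-cell are the string of length $0$ on that $i$-cell). They carry the unit $A\to T^{(n)}_iA$ to the identity on $m$-cells with $m\le i$, and to the inclusion of strings of length one on $m$-cells with $m>i$. -/

import Mathlib

open CategoryTheory MonoidalCategory

universe u

/-! ### Graphs enriched in a category -/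

/-- A `V`-graph: a set of objects and, for every pair of objects, an object of `V`. -/
structure VGraph (V : Type (u + 1)) : Type (u + 1) where
  /-- the set of objects -/
  Obj : Type u
  /-- the object `A(a, b)` of `V` -/
  edge : Obj → Obj → V

namespace VGraph

/-- A morphism of `V`-graphs. -/
structure Hom {V : Type (u + 1)} [Category.{u} V] (A B : VGraph.{u} V) : Type u where
  /-- the function on objects -/
  obj : A.Obj → B.Obj
  /-- the morphisms `A(a, b) ⟶ B(Fa, Fb)` of `V` -/
  map : ∀ a b : A.Obj, A.edge a b ⟶ B.edge (obj a) (obj b)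

/-- The category of `V`-graphs. -/
instance category (V : Type (u + 1)) [Category.{u} V] : Category.{u} (VGraph.{u} V) where
  Hom A B := Hom A B
  id A := ⟨fun a => a, fun _ _ => 𝟙 _⟩
  comp F G := ⟨fun a => G.obj (F.obj a), fun a b => F.map a b ≫ G.map (F.obj a) (F.obj b)⟩
  id_comp F := congrArg (Hom.mk F.obj) (by funext a b; exact Category.id_comp _)
  comp_id F := congrArg (Hom.mk F.obj) (by funext a b; exact Category.comp_id _)
  assoc F G H := congrArg (Hom.mk fun a => H.obj (G.obj (F.obj a)))
    (by funext a b; exact Category.assoc _ _ _)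

/-- The functor `F_* : V-Gph ⥤ W-Gph` that applies `F : V ⥤ W` to the edges. -/
def pushforward {V W : Type (u + 1)} [Category.{u} V] [Category.{u} W] (F : V ⥤ W) :
    VGraph.{u} V ⥤ VGraph.{u} W where
  obj A := ⟨A.Obj, fun a b => F.obj (A.edge a b)⟩
  map f := ⟨f.obj, fun a b => F.map (f.map a b)⟩
  map_id A := congrArg (Hom.mk fun a => a) (by funext a b; exact F.map_id _)
  map_comp {A B C} f g := congrArg (Hom.mk (A := ⟨A.Obj, fun a b => F.obj (A.edge a b)⟩)
    (B := ⟨C.Obj, fun a b => F.obj (C.edge a b)⟩) fun a => g.obj (f.obj a))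
    (by funext a b; exact F.map_comp (f.map a b) (g.map (f.obj a) (f.obj b)))

theorem hom_mk_congr {V : Type (u + 1)} [Category.{u} V] {A B : VGraph.{u} V} {f : A.Obj → B.Obj}
    {m m' : ∀ a b : A.Obj, A.edge a b ⟶ B.edge (f a) (f b)} (h : ∀ a b, m a b = m' a b) :
    (Hom.mk f m : A ⟶ B) = Hom.mk f m' :=
  congrArg (Hom.mk f) (by funext a b; exact h a b)

section Cartesian

variable {V : Type (u + 1)} [Category.{u} V] [CartesianMonoidalCategory V]

/-- The product of two `V`-graphs. -/
def prod (A B : VGraph.{u} V) : VGraph.{u} V :=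
  ⟨A.Obj × B.Obj, fun p q => A.edge p.1 q.1 ⊗ B.edge p.2 q.2⟩

/-- The terminal `V`-graph. -/
def unit : VGraph.{u} V := ⟨PUnit, fun _ _ => 𝟙_ V⟩

/-- The product of two morphisms of `V`-graphs. -/
def prodMap {A A' B B' : VGraph.{u} V} (f : A ⟶ A') (g : B ⟶ B') : prod A B ⟶ prod A' B' :=
  Hom.mk (A := prod A B) (B := prod A' B') (fun p => (f.obj p.1, g.obj p.2))
    (fun p q => f.map p.1 q.1 ⊗ₘ g.map p.2 q.2)

/-- The associativity isomorphism of products of `V`-graphs. -/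
def prodAssoc (A B C : VGraph.{u} V) : prod (prod A B) C ≅ prod A (prod B C) where
  hom := Hom.mk (A := prod (prod A B) C) (B := prod A (prod B C))
    (fun p => (p.1.1, (p.1.2, p.2))) (fun _ _ => (α_ _ _ _).hom)
  inv := Hom.mk (A := prod A (prod B C)) (B := prod (prod A B) C)
    (fun p => ((p.1, p.2.1), p.2.2)) (fun _ _ => (α_ _ _ _).inv)
  hom_inv_id := congrArg (Hom.mk (A := prod (prod A B) C) (B := prod (prod A B) C) fun p => p)
    (by funext p q; exact Iso.hom_inv_id _)
  inv_hom_id := congrArg (Hom.mk (A := prod A (prod B C)) (B := prod A (prod B C)) fun p => p)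
    (by funext p q; exact Iso.inv_hom_id _)

/-- The left unit isomorphism of products of `V`-graphs. -/
def unitProd (A : VGraph.{u} V) : prod unit A ≅ A where
  hom := Hom.mk (A := prod unit A) (B := A) (fun p => p.2) (fun _ _ => (λ_ _).hom)
  inv := Hom.mk (A := A) (B := prod unit A) (fun a => (PUnit.unit, a)) (fun _ _ => (λ_ _).inv)
  hom_inv_id := congrArg (Hom.mk (A := prod unit A) (B := prod unit A) fun p => p)
    (by funext p q; exact Iso.hom_inv_id _)
  inv_hom_id := congrArg (Hom.mk (A := A) (B := A) fun p => p)
    (by funext p q; exact Iso.inv_hom_id _)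

/-- The right unit isomorphism of products of `V`-graphs. -/
def prodUnit (A : VGraph.{u} V) : prod A unit ≅ A where
  hom := Hom.mk (A := prod A unit) (B := A) (fun p => p.1) (fun _ _ => (ρ_ _).hom)
  inv := Hom.mk (A := A) (B := prod A unit) (fun a => (a, PUnit.unit)) (fun _ _ => (ρ_ _).inv)
  hom_inv_id := congrArg (Hom.mk (A := prod A unit) (B := prod A unit) fun p => p)
    (by funext p q; exact Iso.hom_inv_id _)
  inv_hom_id := congrArg (Hom.mk (A := A) (B := A) fun p => p)
    (by funext p q; exact Iso.inv_hom_id _)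

/-- The cartesian products of `V`-graphs as a monoidal structure. -/
instance monoidalStruct : MonoidalCategoryStruct (VGraph.{u} V) where
  tensorObj := prod
  tensorUnit := unit
  tensorHom := prodMap
  whiskerLeft A _ _ g := prodMap (𝟙 A) g
  whiskerRight f B := prodMap f (𝟙 B)
  associator := prodAssoc
  leftUnitor := unitProd
  rightUnitor := prodUnit

instance monoidal : MonoidalCategory (VGraph.{u} V) := MonoidalCategory.ofTensorHom
  (id_tensorHom_id := fun A B => hom_mk_congr fun p q => id_tensorHom_id _ _)
  (id_tensorHom := fun _ _ _ _ => rfl)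
  (tensorHom_id := fun _ _ => rfl)
  (tensorHom_comp_tensorHom := fun f₁ f₂ g₁ g₂ => hom_mk_congr fun p q =>
    tensorHom_comp_tensorHom (f₁.map _ _) (f₂.map _ _) (g₁.map _ _) (g₂.map _ _))
  (associator_naturality := fun f g h => hom_mk_congr fun p q =>
    associator_naturality (f.map _ _) (g.map _ _) (h.map _ _))
  (leftUnitor_naturality := fun f => hom_mk_congr fun p q => by
    have := leftUnitor_naturality (f.map p.2 q.2)
    rw [← id_tensorHom] at this; exact this)
  (rightUnitor_naturality := fun f => hom_mk_congr fun p q => by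
    have := rightUnitor_naturality (f.map p.1 q.1)
    rw [← tensorHom_id] at this; exact this)
  (pentagon := fun A B C D => hom_mk_congr fun p q => by
    have := MonoidalCategory.pentagon (A.edge p.1.1.1 q.1.1.1) (B.edge p.1.1.2 q.1.1.2)
      (C.edge p.1.2 q.1.2) (D.edge p.2 q.2)
    rw [← tensorHom_id, ← id_tensorHom] at this; exact this)
  (triangle := fun A B => hom_mk_congr fun p q => by
    have := MonoidalCategory.triangle (A.edge p.1.1 q.1.1) (B.edge p.2 q.2)
    rw [← tensorHom_id, ← id_tensorHom] at this; exact this)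

/-- Products of `V`-graphs are cartesian products. -/
instance cartesian : CartesianMonoidalCategory (VGraph.{u} V) where
  isTerminalTensorUnit := Limits.IsTerminal.ofUniqueHom
    (fun A => (Hom.mk (fun _ => PUnit.unit)
      (fun _ _ => SemiCartesianMonoidalCategory.toUnit _) : Hom A unit))
    (fun A f => hom_mk_congr (B := unit)
      (m := fun a b => f.map a b) fun _ _ => SemiCartesianMonoidalCategory.toUnit_unique _ _)
  fst A B := Hom.mk (A := prod A B) (fun p => p.1)
    (fun _ _ => SemiCartesianMonoidalCategory.fst _ _)
  snd A B := Hom.mk (A := prod A B) (fun p => p.2)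
    (fun _ _ => SemiCartesianMonoidalCategory.snd _ _)
  tensorProductIsBinaryProduct A B := Limits.BinaryFan.IsLimit.mk _
    (fun {T} f g => (Hom.mk (B := prod A B) (fun t => (f.obj t, g.obj t))
      (fun a b => CartesianMonoidalCategory.lift (f.map a b) (g.map a b)) : Hom T (prod A B)))
    (fun f g => hom_mk_congr fun _ _ => CartesianMonoidalCategory.lift_fst _ _)
    (fun f g => hom_mk_congr fun _ _ => CartesianMonoidalCategory.lift_snd _ _)
    (by
      intro T f g m h₁ h₂
      subst h₁ h₂
      refine hom_mk_congr (A := T) (B := prod A B) (f := m.obj) fun a b => ?_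
      exact CartesianMonoidalCategory.hom_ext _ _
        (CartesianMonoidalCategory.lift_fst _ _).symm
        (CartesianMonoidalCategory.lift_snd _ _).symm)
  fst_def := fun A B => by
    refine hom_mk_congr (A := prod A B) (f := fun p => p.1) fun p q => ?_
    have := SemiCartesianMonoidalCategory.fst_def (A.edge p.1 q.1) (B.edge p.2 q.2)
    rw [← id_tensorHom] at this
    exact this
  snd_def := fun A B => by
    refine hom_mk_congr (A := prod A B) (f := fun p => p.2) fun p q => ?_
    have := SemiCartesianMonoidalCategory.snd_def (A.edge p.1 q.1) (B.edge p.2 q.2)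
    rw [← tensorHom_id] at this
    exact this

end Cartesian

end VGraph

/-! ### Categories enriched in a monoidal category -/

/-- A small `V`-category: a set of objects with a `V`-enriched category structure. -/
structure VCat (V : Type (u + 1)) [Category.{u} V] [MonoidalCategory V] : Type (u + 1) where
  /-- the set of objects -/
  Obj : Type u
  /-- the enriched category structure -/
  [enriched : EnrichedCategory V Obj]

namespace VCat

attribute [instance] VCat.enriched

variable (V : Type (u + 1)) [Category.{u} V] [MonoidalCategory V]

/-- The category of small `V`-categories and `V`-functors. -/
instance category : Category.{u} (VCat.{u} V) where
  Hom C D := EnrichedFunctor V C.Obj D.Obj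
  id C := EnrichedFunctor.id V C.Obj
  comp F G := EnrichedFunctor.comp V F G
  id_comp _ := EnrichedFunctor.ext V (fun _ => rfl) fun _ _ =>
    (Category.comp_id _).trans (Category.id_comp _)
  comp_id _ := EnrichedFunctor.ext V (fun _ => rfl) fun _ _ =>
    (Category.comp_id _).trans (Category.comp_id _)
  assoc _ _ _ := EnrichedFunctor.ext V (fun _ => rfl) fun _ _ =>
    (Category.comp_id _).trans (Category.assoc _ _ _)

/-- The forgetful functor `V-Cat ⥤ V-Gph`. -/
def forget : VCat.{u} V ⥤ VGraph.{u} V where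
  obj C := ⟨C.Obj, fun a b => EnrichedCategory.Hom a b⟩
  map F := ⟨EnrichedFunctor.obj F, EnrichedFunctor.map F⟩
  map_id _ := rfl
  map_comp _ _ := rfl

end VCat

/-! ### `n`-graphs and the categories `[(n-i-1)-Gph]-Cat-[i-Gph]` -/

/-- A bundled category. -/
structure BundledCat : Type (u + 2) where
  /-- the objects -/
  carrier : Type (u + 1)
  /-- the category structure -/
  cat : Category.{u} carrier

/-- A bundled category with chosen finite products. -/
structure BundledCart : Type (u + 2) extends BundledCat.{u} where
  /-- the chosen finite products -/
  cart : @CartesianMonoidalCategory carrier cat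

/-- `0-Gph = Set` and `(n+1)-Gph = (n-Gph)-Gph`, with their finite products. -/
def bundledGph : ℕ → BundledCart.{u}
  | 0 => ⟨⟨Type u, inferInstance⟩, inferInstance⟩
  | n + 1 =>
    letI := (bundledGph n).cat
    letI := (bundledGph n).cart
    ⟨⟨VGraph.{u} (bundledGph n).carrier, inferInstance⟩, inferInstance⟩

/-- The category `n-Gph`. -/
def NGph (n : ℕ) : Type (u + 1) := (bundledGph.{u} n).carrier

instance NGph.category (n : ℕ) : Category.{u} (NGph.{u} n) := (bundledGph.{u} n).cat

instance NGph.cartesian (n : ℕ) : CartesianMonoidalCategory (NGph.{u} n) :=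
  (bundledGph.{u} n).cart

/-- For `i < n`, the category `[(n-i-1)-Gph]-Cat-[i-Gph]`: this is `((n-1)-Gph)-Cat` for `i = 0`,
and the category of graphs enriched in `[(n-i-1)-Gph]-Cat-[(i-1)-Gph]` for `i > 0`. -/
def bundledCatGph : (n i : ℕ) → i < n → BundledCat.{u}
  | 0, _, h => absurd h (Nat.not_lt_zero _)
  | n + 1, 0, _ => ⟨VCat.{u} (NGph.{u} n), inferInstance⟩
  | n + 1, i + 1, h =>
    ⟨VGraph.{u} (bundledCatGph n i (Nat.lt_of_succ_lt_succ h)).carrier,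
      @VGraph.category _ (bundledCatGph n i (Nat.lt_of_succ_lt_succ h)).cat⟩

/-- The category `[(n-i-1)-Gph]-Cat-[i-Gph]`. -/
def CatGph (n i : ℕ) (h : i < n) : Type (u + 1) := (bundledCatGph.{u} n i h).carrier

instance CatGph.category (n i : ℕ) (h : i < n) : Category.{u} (CatGph.{u} n i h) :=
  (bundledCatGph.{u} n i h).cat

/-- The forgetful functor `[(n-i-1)-Gph]-Cat-[i-Gph] ⥤ n-Gph`. -/
def CatGph.forget : (n i : ℕ) → (h : i < n) → CatGph.{u} n i h ⥤ NGph.{u} n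
  | 0, _, h => absurd h (Nat.not_lt_zero _)
  | n + 1, 0, _ => VCat.forget.{u} (NGph.{u} n)
  | n + 1, i + 1, h =>
    VGraph.pushforward.{u} (V := CatGph.{u} n i (Nat.lt_of_succ_lt_succ h)) (W := NGph.{u} n)
      (CatGph.forget n i (Nat.lt_of_succ_lt_succ h))

/-! ### Globular sets -/

/-- An `n`-globular set. -/
structure GSet (n : ℕ) : Type (u + 1) where
  /-- the set `A(m)` of `m`-cells, for `m ≤ n` -/
  cell : (m : ℕ) → m ≤ n → Type u
  /-- the source maps -/
  s : (m : ℕ) → (h : m + 1 ≤ n) → cell (m + 1) h → cell m (Nat.le_of_succ_le h)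
  /-- the target maps -/
  t : (m : ℕ) → (h : m + 1 ≤ n) → cell (m + 1) h → cell m (Nat.le_of_succ_le h)
  s_s : ∀ (m : ℕ) (h : m + 2 ≤ n) (x : cell (m + 2) h),
    s m (Nat.le_of_succ_le h) (s (m + 1) h x) = s m (Nat.le_of_succ_le h) (t (m + 1) h x)
  t_s : ∀ (m : ℕ) (h : m + 2 ≤ n) (x : cell (m + 2) h),
    t m (Nat.le_of_succ_le h) (s (m + 1) h x) = t m (Nat.le_of_succ_le h) (t (m + 1) h x)

namespace GSet

variable {n : ℕ}

/-- A morphism of `n`-globular sets. -/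
@[ext]
structure Hom (X Y : GSet.{u} n) : Type u where
  /-- the functions on cells -/
  app : (m : ℕ) → (h : m ≤ n) → X.cell m h → Y.cell m h
  app_s : ∀ (m : ℕ) (h : m + 1 ≤ n) (x : X.cell (m + 1) h),
    app m (Nat.le_of_succ_le h) (X.s m h x) = Y.s m h (app (m + 1) h x)
  app_t : ∀ (m : ℕ) (h : m + 1 ≤ n) (x : X.cell (m + 1) h),
    app m (Nat.le_of_succ_le h) (X.t m h x) = Y.t m h (app (m + 1) h x)

/-- The category of `n`-globular sets. -/
instance category : Category.{u} (GSet.{u} n) where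
  Hom X Y := Hom X Y
  id X := ⟨fun _ _ x => x, fun _ _ _ => rfl, fun _ _ _ => rfl⟩
  comp f g := ⟨fun m h x => g.app m h (f.app m h x),
    fun m h x => by rw [f.app_s, g.app_s], fun m h x => by rw [f.app_t, g.app_t]⟩

end GSet

/-! ### The globular set of an `n`-graph -/

namespace NGph

/-- The `m`-cells of an `n`-graph: the elements of the set for `n = 0`, the objects for `m = 0 < n`,
and the `(m-1)`-cells of all the `A(a, b)` for `m > 0`. -/
def cell : (n m : ℕ) → m ≤ n → NGph.{u} n → Type u
  | 0, 0, _, A => A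
  | _ + 1, 0, _, A => VGraph.Obj A
  | 0, _ + 1, h, _ => absurd h (Nat.not_succ_le_zero _)
  | n + 1, m + 1, h, A => Σ a b : VGraph.Obj A, cell n m (Nat.le_of_succ_le_succ h)
      (VGraph.edge A a b)

/-- The source of a cell of an `n`-graph. -/
def src : (n m : ℕ) → (h : m + 1 ≤ n) → (A : NGph.{u} n) →
    cell n (m + 1) h A → cell n m (Nat.le_of_succ_le h) A
  | 0, _, h, _, _ => absurd h (Nat.not_succ_le_zero _)
  | _ + 1, 0, _, _, x => x.1
  | n + 1, m + 1, h, _, x => ⟨x.1, x.2.1, src n m (Nat.le_of_succ_le_succ h) _ x.2.2⟩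

/-- The target of a cell of an `n`-graph. -/
def tgt : (n m : ℕ) → (h : m + 1 ≤ n) → (A : NGph.{u} n) →
    cell n (m + 1) h A → cell n m (Nat.le_of_succ_le h) A
  | 0, _, h, _, _ => absurd h (Nat.not_succ_le_zero _)
  | _ + 1, 0, _, _, x => x.2.1
  | n + 1, m + 1, h, _, x => ⟨x.1, x.2.1, tgt n m (Nat.le_of_succ_le_succ h) _ x.2.2⟩

/-- A morphism of `(n+1)`-graphs as a morphism of graphs enriched in `n`-graphs. -/
def toHom {n : ℕ} {A B : NGph.{u} (n + 1)} (f : A ⟶ B) :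
    VGraph.Hom (V := NGph.{u} n) A B := f

/-- The action of a morphism of `n`-graphs on cells. -/
def mapCell : (n m : ℕ) → (h : m ≤ n) → {A B : NGph.{u} n} → (A ⟶ B) →
    cell n m h A → cell n m h B
  | 0, 0, _, _, _, f, x => (ConcreteCategory.hom (C := Type u) f).toFun x
  | _ + 1, 0, _, _, _, f, x => (toHom f).obj x
  | 0, _ + 1, h, _, _, _, _ => absurd h (Nat.not_succ_le_zero _)
  | n + 1, m + 1, h, _, _, f, x => ⟨(toHom f).obj x.1, (toHom f).obj x.2.1,
      mapCell n m (Nat.le_of_succ_le_succ h) ((toHom f).map x.1 x.2.1) x.2.2⟩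

/-- An `m`-cell of `A(a, b)` as an `(m+1)`-cell of `A`. -/
def consCell {n m : ℕ} {h : m ≤ n} (A : NGph.{u} (n + 1)) (a b : VGraph.Obj A)
    (x : cell n m h (VGraph.edge A a b)) : cell (n + 1) (m + 1) (Nat.succ_le_succ h) A :=
  ⟨a, b, x⟩

theorem src_src : ∀ (n m : ℕ) (h : m + 2 ≤ n) (A : NGph.{u} n) (x : cell n (m + 2) h A),
    src n m (Nat.le_of_succ_le h) A (src n (m + 1) h A x) =
      src n m (Nat.le_of_succ_le h) A (tgt n (m + 1) h A x)
  | 0, _, h, _, _ => absurd h (Nat.not_succ_le_zero _)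
  | _ + 1, 0, _, _, _ => rfl
  | n + 1, m + 1, h, A, x => by
    obtain ⟨a, b, x⟩ := x
    exact congrArg (consCell A a b)
      (src_src n m (Nat.le_of_succ_le_succ h) _ x)

theorem tgt_src : ∀ (n m : ℕ) (h : m + 2 ≤ n) (A : NGph.{u} n) (x : cell n (m + 2) h A),
    tgt n m (Nat.le_of_succ_le h) A (src n (m + 1) h A x) =
      tgt n m (Nat.le_of_succ_le h) A (tgt n (m + 1) h A x)
  | 0, _, h, _, _ => absurd h (Nat.not_succ_le_zero _)
  | _ + 1, 0, _, _, _ => rfl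
  | n + 1, m + 1, h, A, x => by
    obtain ⟨a, b, x⟩ := x
    exact congrArg (consCell A a b)
      (tgt_src n m (Nat.le_of_succ_le_succ h) _ x)

theorem mapCell_src : ∀ (n m : ℕ) (h : m + 1 ≤ n) {A B : NGph.{u} n} (f : A ⟶ B)
    (x : cell n (m + 1) h A),
    mapCell n m (Nat.le_of_succ_le h) f (src n m h A x) =
      src n m h B (mapCell n (m + 1) h f x)
  | 0, _, h, _, _, _, _ => absurd h (Nat.not_succ_le_zero _)
  | _ + 1, 0, _, _, _, _, _ => rfl
  | n + 1, m + 1, h, A, B, f, x => by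
    obtain ⟨a, b, x⟩ := x
    exact congrArg (consCell B ((toHom f).obj a) ((toHom f).obj b))
      (mapCell_src n m (Nat.le_of_succ_le_succ h) ((toHom f).map a b) x)

theorem mapCell_tgt : ∀ (n m : ℕ) (h : m + 1 ≤ n) {A B : NGph.{u} n} (f : A ⟶ B)
    (x : cell n (m + 1) h A),
    mapCell n m (Nat.le_of_succ_le h) f (tgt n m h A x) =
      tgt n m h B (mapCell n (m + 1) h f x)
  | 0, _, h, _, _, _, _ => absurd h (Nat.not_succ_le_zero _)
  | _ + 1, 0, _, _, _, _, _ => rfl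
  | n + 1, m + 1, h, A, B, f, x => by
    obtain ⟨a, b, x⟩ := x
    exact congrArg (consCell B ((toHom f).obj a) ((toHom f).obj b))
      (mapCell_tgt n m (Nat.le_of_succ_le_succ h) ((toHom f).map a b) x)

theorem mapCell_id : ∀ (n m : ℕ) (h : m ≤ n) (A : NGph.{u} n) (x : cell n m h A),
    mapCell n m h (𝟙 A) x = x
  | 0, 0, _, _, _ => rfl
  | _ + 1, 0, _, _, _ => rfl
  | 0, _ + 1, h, _, _ => absurd h (Nat.not_succ_le_zero _)
  | n + 1, m + 1, h, A, x => by
    obtain ⟨a, b, x⟩ := x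
    exact congrArg (consCell A a b)
      (mapCell_id n m (Nat.le_of_succ_le_succ h) _ x)

theorem mapCell_comp : ∀ (n m : ℕ) (h : m ≤ n) {A B C : NGph.{u} n} (f : A ⟶ B) (g : B ⟶ C)
    (x : cell n m h A), mapCell n m h (f ≫ g) x = mapCell n m h g (mapCell n m h f x)
  | 0, 0, _, _, _, _, _, _, _ => rfl
  | _ + 1, 0, _, _, _, _, _, _, _ => rfl
  | 0, _ + 1, h, _, _, _, _, _, _ => absurd h (Nat.not_succ_le_zero _)
  | n + 1, m + 1, h, A, B, C, f, g, x => by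
    obtain ⟨a, b, x⟩ := x
    exact congrArg (consCell C ((toHom g).obj ((toHom f).obj a)) ((toHom g).obj ((toHom f).obj b)))
      (mapCell_comp n m (Nat.le_of_succ_le_succ h) ((toHom f).map a b) ((toHom g).map _ _) x)

/-- The functor that sends an `n`-graph to its `n`-globular set of cells. -/
def toGSet (n : ℕ) : NGph.{u} n ⥤ GSet.{u} n where
  obj A := ⟨fun m h => cell n m h A, fun m h => src n m h A, fun m h => tgt n m h A,
    fun m h => src_src n m h A, fun m h => tgt_src n m h A⟩
  map f := ⟨fun m h => mapCell n m h f, fun m h => mapCell_src n m h f,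
    fun m h => mapCell_tgt n m h f⟩
  map_id A := GSet.Hom.ext (by funext m h x; exact mapCell_id n m h A x)
  map_comp f g := GSet.Hom.ext (by funext m h x; exact mapCell_comp n m h f g x)

end NGph

/-! ### Free strings of `i`-composable cells -/

namespace GSet

variable {n : ℕ}

/-- Cells of equal dimensions. -/
def castCell (X : GSet.{u} n) {i m : ℕ} (e : i = m) (hi : i ≤ n) (hm : m ≤ n) (x : X.cell i hi) :
    X.cell m hm := by
  subst e
  exact x

/-- The iterated source map `A(m) → A(i)`, for `i ≤ m`. -/
def srcTo (X : GSet.{u} n) (i : ℕ) (hi : i ≤ n) : (m : ℕ) → (hm : m ≤ n) → i ≤ m →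
    X.cell m hm → X.cell i hi
  | 0, hm, h, x => X.castCell (Nat.le_zero.1 h).symm hm hi x
  | m + 1, hm, h, x =>
    if h' : i ≤ m then X.srcTo i hi m (Nat.le_of_succ_le hm) h' (X.s m hm x)
    else X.castCell (by omega) hm hi x

/-- The iterated target map `A(m) → A(i)`, for `i ≤ m`. -/
def tgtTo (X : GSet.{u} n) (i : ℕ) (hi : i ≤ n) : (m : ℕ) → (hm : m ≤ n) → i ≤ m →
    X.cell m hm → X.cell i hi
  | 0, hm, h, x => X.castCell (Nat.le_zero.1 h).symm hm hi x
  | m + 1, hm, h, x =>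
    if h' : i ≤ m then X.tgtTo i hi m (Nat.le_of_succ_le hm) h' (X.t m hm x)
    else X.castCell (by omega) hm hi x

/-- The `k`-fold wide pullback `A(m) ×_{A(i)} ⋯ ×_{A(i)} A(m)`, for `i < m`: strings of `k`
`m`-cells such that the target `i`-cell of each is the source `i`-cell of the next. The `i`-cells
along which the pullback is taken are recorded; for `k = 0` the pullback is `A(i)`. -/
@[ext]
structure Str (X : GSet.{u} n) (i : ℕ) (hi : i ≤ n) (m : ℕ) (hm : m ≤ n) (h : i < m) (k : ℕ) :
    Type u where
  /-- the `i`-cells -/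
  vertex : Fin (k + 1) → X.cell i hi
  /-- the `m`-cells -/
  arrow : Fin k → X.cell m hm
  src_arrow : ∀ j, X.srcTo i hi m hm h.le (arrow j) = vertex j.castSucc
  tgt_arrow : ∀ j, X.tgtTo i hi m hm h.le (arrow j) = vertex j.succ

theorem srcTo_self (X : GSet.{u} n) (i : ℕ) (hi : i ≤ n) (x : X.cell i hi) :
    X.srcTo i hi i hi le_rfl x = x := by
  cases i with
  | zero => rfl
  | succ i => rw [srcTo, dif_neg (by omega)]; rfl

theorem tgtTo_self (X : GSet.{u} n) (i : ℕ) (hi : i ≤ n) (x : X.cell i hi) :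
    X.tgtTo i hi i hi le_rfl x = x := by
  cases i with
  | zero => rfl
  | succ i => rw [tgtTo, dif_neg (by omega)]; rfl

theorem srcTo_succ (X : GSet.{u} n) (i : ℕ) (hi : i ≤ n) (m : ℕ) (hm : m + 1 ≤ n) (h : i ≤ m)
    (x : X.cell (m + 1) hm) :
    X.srcTo i hi (m + 1) hm (Nat.le_succ_of_le h) x =
      X.srcTo i hi m (Nat.le_of_succ_le hm) h (X.s m hm x) := by
  rw [srcTo, dif_pos h]

theorem tgtTo_succ (X : GSet.{u} n) (i : ℕ) (hi : i ≤ n) (m : ℕ) (hm : m + 1 ≤ n) (h : i ≤ m)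
    (x : X.cell (m + 1) hm) :
    X.tgtTo i hi (m + 1) hm (Nat.le_succ_of_le h) x =
      X.tgtTo i hi m (Nat.le_of_succ_le hm) h (X.t m hm x) := by
  rw [tgtTo, dif_pos h]

theorem srcTo_t (X : GSet.{u} n) (i : ℕ) (hi : i ≤ n) (m : ℕ) (hm : m + 1 ≤ n) (h : i < m)
    (x : X.cell (m + 1) hm) :
    X.srcTo i hi m (Nat.le_of_succ_le hm) h.le (X.t m hm x) =
      X.srcTo i hi (m + 1) hm (Nat.le_succ_of_le h.le) x := by
  obtain _ | m := m
  · exact absurd h (Nat.not_lt_zero _)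
  · have h' : i ≤ m := Nat.le_of_lt_succ h
    rw [srcTo_succ X i hi (m + 1) hm h.le, srcTo_succ X i hi m _ h', srcTo_succ X i hi m _ h',
      X.s_s m hm x]

theorem tgtTo_s (X : GSet.{u} n) (i : ℕ) (hi : i ≤ n) (m : ℕ) (hm : m + 1 ≤ n) (h : i < m)
    (x : X.cell (m + 1) hm) :
    X.tgtTo i hi m (Nat.le_of_succ_le hm) h.le (X.s m hm x) =
      X.tgtTo i hi (m + 1) hm (Nat.le_succ_of_le h.le) x := by
  obtain _ | m := m
  · exact absurd h (Nat.not_lt_zero _)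
  · have h' : i ≤ m := Nat.le_of_lt_succ h
    rw [tgtTo_succ X i hi (m + 1) hm h.le, tgtTo_succ X i hi m _ h', tgtTo_succ X i hi m _ h',
      X.t_s m hm x]

theorem s_srcTo (X : GSet.{u} n) (i : ℕ) (hi : i + 1 ≤ n) (m : ℕ) (hm : m ≤ n) (h : i + 1 ≤ m)
    (x : X.cell m hm) :
    X.s i hi (X.srcTo (i + 1) hi m hm h x) =
      X.srcTo i (Nat.le_of_succ_le hi) m hm (Nat.le_of_succ_le h) x := by
  induction m, h using Nat.le_induction with
  | base =>
    rw [srcTo_self, srcTo_succ X i (Nat.le_of_succ_le hi) i hi le_rfl, srcTo_self]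
  | succ m h ih =>
    rw [srcTo_succ X (i + 1) hi m hm h, srcTo_succ X i _ m hm (Nat.le_of_succ_le h), ih]

theorem t_tgtTo (X : GSet.{u} n) (i : ℕ) (hi : i + 1 ≤ n) (m : ℕ) (hm : m ≤ n) (h : i + 1 ≤ m)
    (x : X.cell m hm) :
    X.t i hi (X.tgtTo (i + 1) hi m hm h x) =
      X.tgtTo i (Nat.le_of_succ_le hi) m hm (Nat.le_of_succ_le h) x := by
  induction m, h using Nat.le_induction with
  | base =>
    rw [tgtTo_self, tgtTo_succ X i (Nat.le_of_succ_le hi) i hi le_rfl, tgtTo_self]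
  | succ m h ih =>
    rw [tgtTo_succ X (i + 1) hi m hm h, tgtTo_succ X i _ m hm (Nat.le_of_succ_le h), ih]

theorem s_tgtTo (X : GSet.{u} n) (i : ℕ) (hi : i + 1 ≤ n) (m : ℕ) (hm : m ≤ n) (h : i + 1 < m)
    (x : X.cell m hm) :
    X.s i hi (X.tgtTo (i + 1) hi m hm h.le x) = X.s i hi (X.srcTo (i + 1) hi m hm h.le x) := by
  induction m, h using Nat.le_induction with
  | base =>
    rw [srcTo_succ X (i + 1) hi (i + 1) hm le_rfl, tgtTo_succ X (i + 1) hi (i + 1) hm le_rfl,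
      srcTo_self, tgtTo_self, X.s_s]
  | succ m h ih =>
    have h' : i + 1 < m := h
    rw [srcTo_succ X (i + 1) hi m hm h'.le, ← tgtTo_s X (i + 1) hi m hm h', ih]

theorem t_srcTo (X : GSet.{u} n) (i : ℕ) (hi : i + 1 ≤ n) (m : ℕ) (hm : m ≤ n) (h : i + 1 < m)
    (x : X.cell m hm) :
    X.t i hi (X.tgtTo (i + 1) hi m hm h.le x) = X.t i hi (X.srcTo (i + 1) hi m hm h.le x) := by
  induction m, h using Nat.le_induction with
  | base =>
    rw [srcTo_succ X (i + 1) hi (i + 1) hm le_rfl, tgtTo_succ X (i + 1) hi (i + 1) hm le_rfl,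
      srcTo_self, tgtTo_self, X.t_s]
  | succ m h ih =>
    have h' : i + 1 < m := h
    rw [srcTo_succ X (i + 1) hi m hm h'.le, ← tgtTo_s X (i + 1) hi m hm h', ih]

theorem Hom.app_castCell {X Y : GSet.{u} n} (f : Hom X Y) {i m : ℕ} (e : i = m) (hi : i ≤ n)
    (hm : m ≤ n) (x : X.cell i hi) :
    f.app m hm (X.castCell e hi hm x) = Y.castCell e hi hm (f.app i hi x) := by
  subst e
  rfl

theorem Hom.app_srcTo {X Y : GSet.{u} n} (f : Hom X Y) (i : ℕ) (hi : i ≤ n) (m : ℕ) (hm : m ≤ n)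
    (h : i ≤ m) (x : X.cell m hm) :
    f.app i hi (X.srcTo i hi m hm h x) = Y.srcTo i hi m hm h (f.app m hm x) := by
  induction m, h using Nat.le_induction with
  | base => rw [srcTo_self, srcTo_self]
  | succ m h ih => rw [srcTo_succ X i hi m hm h, srcTo_succ Y i hi m hm h, ih, f.app_s]

theorem Hom.app_tgtTo {X Y : GSet.{u} n} (f : Hom X Y) (i : ℕ) (hi : i ≤ n) (m : ℕ) (hm : m ≤ n)
    (h : i ≤ m) (x : X.cell m hm) :
    f.app i hi (X.tgtTo i hi m hm h x) = Y.tgtTo i hi m hm h (f.app m hm x) := by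
  induction m, h using Nat.le_induction with
  | base => rw [tgtTo_self, tgtTo_self]
  | succ m h ih => rw [tgtTo_succ X i hi m hm h, tgtTo_succ Y i hi m hm h, ih, f.app_t]

namespace Str

variable {X Y : GSet.{u} n} {i : ℕ} {hi : i ≤ n} {k : ℕ}

/-- The string of the sources of the cells of a string. -/
def s {m : ℕ} {hm : m + 1 ≤ n} (h : i < m)
    (w : X.Str i hi (m + 1) hm (Nat.lt_succ_of_lt h) k) :
    X.Str i hi m (Nat.le_of_succ_le hm) h k where
  vertex := w.vertex
  arrow j := X.s m hm (w.arrow j)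
  src_arrow j := by rw [← srcTo_succ X i hi m hm h.le]; exact w.src_arrow j
  tgt_arrow j := by rw [tgtTo_s X i hi m hm h]; exact w.tgt_arrow j

/-- The string of the targets of the cells of a string. -/
def t {m : ℕ} {hm : m + 1 ≤ n} (h : i < m)
    (w : X.Str i hi (m + 1) hm (Nat.lt_succ_of_lt h) k) :
    X.Str i hi m (Nat.le_of_succ_le hm) h k where
  vertex := w.vertex
  arrow j := X.t m hm (w.arrow j)
  src_arrow j := by rw [srcTo_t X i hi m hm h]; exact w.src_arrow j
  tgt_arrow j := by rw [← tgtTo_succ X i hi m hm h.le]; exact w.tgt_arrow j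

/-- The image of a string under a morphism of globular sets. -/
def map (f : Hom X Y) {m : ℕ} {hm : m ≤ n} {h : i < m} (w : X.Str i hi m hm h k) :
    Y.Str i hi m hm h k where
  vertex j := f.app i hi (w.vertex j)
  arrow j := f.app m hm (w.arrow j)
  src_arrow j := by rw [← f.app_srcTo, w.src_arrow]
  tgt_arrow j := by rw [← f.app_tgtTo, w.tgt_arrow]

/-- The string of length one on a cell. -/
def single {m : ℕ} {hm : m ≤ n} (h : i < m) (x : X.cell m hm) : X.Str i hi m hm h 1 where
  vertex := ![X.srcTo i hi m hm h.le x, X.tgtTo i hi m hm h.le x]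
  arrow _ := x
  src_arrow j := by fin_cases j; rfl
  tgt_arrow j := by fin_cases j; rfl

theorem s_vertex {i : ℕ} {hi : i + 1 ≤ n} {m : ℕ} {hm : m ≤ n} {h : i + 1 < m}
    (w : X.Str (i + 1) hi m hm h k) (j : Fin (k + 1)) :
    X.s i hi (w.vertex j) = X.s i hi (w.vertex 0) := by
  induction j using Fin.induction with
  | zero => rfl
  | succ j ih => rw [← ih, ← w.src_arrow j, ← w.tgt_arrow j, s_tgtTo X i hi m hm h]

theorem t_vertex {i : ℕ} {hi : i + 1 ≤ n} {m : ℕ} {hm : m ≤ n} {h : i + 1 < m}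
    (w : X.Str (i + 1) hi m hm h k) (j : Fin (k + 1)) :
    X.t i hi (w.vertex j) = X.t i hi (w.vertex 0) := by
  induction j using Fin.induction with
  | zero => rfl
  | succ j ih => rw [← ih, ← w.src_arrow j, ← w.tgt_arrow j, t_srcTo X i hi m hm h]

end Str

/-- The `m`-cells of the free `i`-composition: `A(m)` if `m ≤ i`, and the coproduct over `k ≥ 0` of
the `k`-fold wide pullbacks `A(m) ×_{A(i)} ⋯ ×_{A(i)} A(m)` if `i < m`. -/
inductive FreeCell (X : GSet.{u} n) (i : ℕ) (hi : i ≤ n) (m : ℕ) (hm : m ≤ n) : Type u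
  | low (h : m ≤ i) (x : X.cell m hm) : FreeCell X i hi m hm
  | str (h : i < m) (k : ℕ) (w : X.Str i hi m hm h k) : FreeCell X i hi m hm

namespace FreeCell

variable {X Y : GSet.{u} n} {i : ℕ} {hi : i ≤ n}

/-- The source of a string of `(m+1)`-cells is the string of the sources if `i < m`, and the source
of the string (its first `i`-cell) if `m = i`. -/
def s {m : ℕ} {hm : m + 1 ≤ n} (c : X.FreeCell i hi (m + 1) hm) :
    X.FreeCell i hi m (Nat.le_of_succ_le hm) :=
  match c with
  | .low h x => low (Nat.le_of_succ_le h) (X.s m hm x)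
  | .str h k w =>
    if h' : i < m then str h' k (w.s h')
    else low (Nat.le_of_not_lt h') (X.castCell (by omega) hi _ (w.vertex 0))

/-- The target of a string of `(m+1)`-cells is the string of the targets if `i < m`, and the target
of the string (its last `i`-cell) if `m = i`. -/
def t {m : ℕ} {hm : m + 1 ≤ n} (c : X.FreeCell i hi (m + 1) hm) :
    X.FreeCell i hi m (Nat.le_of_succ_le hm) :=
  match c with
  | .low h x => low (Nat.le_of_succ_le h) (X.t m hm x)
  | .str h k w =>
    if h' : i < m then str h' k (w.t h')
    else low (Nat.le_of_not_lt h') (X.castCell (by omega) hi _ (w.vertex (Fin.last k)))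

/-- The action of a morphism of globular sets. -/
def map (f : Hom X Y) {m : ℕ} {hm : m ≤ n} (c : X.FreeCell i hi m hm) : Y.FreeCell i hi m hm :=
  match c with
  | .low h x => low h (f.app m hm x)
  | .str h k w => str h k (w.map f)

/-- An `m`-cell of `A`: itself if `m ≤ i`, and a string of length one if `i < m`. -/
def single {m : ℕ} {hm : m ≤ n} (x : X.cell m hm) : X.FreeCell i hi m hm :=
  if h : i < m then str h 1 (Str.single h x) else low (Nat.le_of_not_lt h) x

theorem s_s {m : ℕ} {hm : m + 2 ≤ n} (x : X.FreeCell i hi (m + 2) hm) : x.s.s = x.t.s := by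
  cases x with
  | low h x => exact congrArg (low _) (X.s_s m hm x)
  | str h k w =>
    rcases lt_trichotomy i (m + 1) with h' | rfl | h'
    · simp only [s, t, dif_pos h']
      by_cases h'' : i < m
      · simp only [dif_pos h'']
        refine congrArg (str h'' k) (Str.ext rfl ?_)
        funext j
        exact X.s_s m hm (w.arrow j)
      · simp only [dif_neg h'']
        rfl
    · simp only [s, t, dif_neg (lt_irrefl _)]
      exact congrArg (low _) (w.s_vertex (Fin.last k)).symm
    · omega

theorem t_s {m : ℕ} {hm : m + 2 ≤ n} (x : X.FreeCell i hi (m + 2) hm) : x.s.t = x.t.t := by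
  cases x with
  | low h x => exact congrArg (low _) (X.t_s m hm x)
  | str h k w =>
    rcases lt_trichotomy i (m + 1) with h' | rfl | h'
    · simp only [s, t, dif_pos h']
      by_cases h'' : i < m
      · simp only [dif_pos h'']
        refine congrArg (str h'' k) (Str.ext rfl ?_)
        funext j
        exact X.t_s m hm (w.arrow j)
      · simp only [dif_neg h'']
        rfl
    · simp only [s, t, dif_neg (lt_irrefl _)]
      exact congrArg (low _) (w.t_vertex (Fin.last k)).symm
    · omega

theorem map_s (f : Hom X Y) {m : ℕ} {hm : m + 1 ≤ n} (x : X.FreeCell i hi (m + 1) hm) :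
    x.s.map f = (x.map f).s := by
  cases x with
  | low h x => exact congrArg (low _) (f.app_s m hm x)
  | str h k w =>
    by_cases h' : i < m
    · simp only [s, map, dif_pos h']
      refine congrArg (str h' k) (Str.ext rfl ?_)
      funext j
      exact f.app_s m hm (w.arrow j)
    · simp only [s, map, dif_neg h']
      exact congrArg (low _) (f.app_castCell _ _ _ _)

theorem map_t (f : Hom X Y) {m : ℕ} {hm : m + 1 ≤ n} (x : X.FreeCell i hi (m + 1) hm) :
    x.t.map f = (x.map f).t := by
  cases x with
  | low h x => exact congrArg (low _) (f.app_t m hm x)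
  | str h k w =>
    by_cases h' : i < m
    · simp only [t, map, dif_pos h']
      refine congrArg (str h' k) (Str.ext rfl ?_)
      funext j
      exact f.app_t m hm (w.arrow j)
    · simp only [t, map, dif_neg h']
      exact congrArg (low _) (f.app_castCell _ _ _ _)

theorem single_s {m : ℕ} {hm : m + 1 ≤ n} (x : X.cell (m + 1) hm) :
    (single (X.s m hm x) : X.FreeCell i hi m _) = (single x : X.FreeCell i hi (m + 1) hm).s := by
  rcases lt_trichotomy i m with h | rfl | h
  · simp only [single, dif_pos h, dif_pos (Nat.lt_succ_of_lt h), s]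
    refine congrArg (str h 1) (Str.ext ?_ rfl)
    simp only [Str.single, Str.s]
    rw [srcTo_succ X i hi m hm h.le, tgtTo_s X i hi m hm h]
  · simp only [single, dif_neg (lt_irrefl _), dif_pos (Nat.lt_succ_self _), s]
    refine congrArg (low _) ?_
    change _ = X.srcTo i hi (i + 1) hm (Nat.le_succ i) x
    rw [srcTo_succ X i hi i hm le_rfl, srcTo_self]
  · simp only [single, dif_neg (Nat.lt_asymm h), dif_neg (Nat.not_lt_of_le h), s]

theorem single_t {m : ℕ} {hm : m + 1 ≤ n} (x : X.cell (m + 1) hm) :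
    (single (X.t m hm x) : X.FreeCell i hi m _) = (single x : X.FreeCell i hi (m + 1) hm).t := by
  rcases lt_trichotomy i m with h | rfl | h
  · simp only [single, dif_pos h, dif_pos (Nat.lt_succ_of_lt h), t]
    refine congrArg (str h 1) (Str.ext ?_ rfl)
    simp only [Str.single, Str.t]
    rw [tgtTo_succ X i hi m hm h.le, srcTo_t X i hi m hm h]
  · simp only [single, dif_neg (lt_irrefl _), dif_pos (Nat.lt_succ_self _), t]
    refine congrArg (low _) ?_
    change _ = X.tgtTo i hi (i + 1) hm (Nat.le_succ i) x
    rw [tgtTo_succ X i hi i hm le_rfl, tgtTo_self]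
  · simp only [single, dif_neg (Nat.lt_asymm h), dif_neg (Nat.not_lt_of_le h), t]

theorem map_single (f : Hom X Y) {m : ℕ} {hm : m ≤ n} (x : X.cell m hm) :
    (single x : X.FreeCell i hi m hm).map f = single (f.app m hm x) := by
  by_cases h : i < m
  · simp only [single, dif_pos h, map]
    refine congrArg (str h 1) (Str.ext ?_ rfl)
    funext j
    fin_cases j
    · exact f.app_srcTo i hi m hm h.le x
    · exact f.app_tgtTo i hi m hm h.le x
  · simp only [single, dif_neg h, map]

end FreeCell

/-- The functor that forms free strings of `i`-composable cells in an `n`-globular set. -/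
def freeStr (n i : ℕ) (hi : i ≤ n) : GSet.{u} n ⥤ GSet.{u} n where
  obj X := ⟨fun m hm => X.FreeCell i hi m hm, fun _ _ x => x.s, fun _ _ x => x.t,
    fun _ _ x => x.s_s, fun _ _ x => x.t_s⟩
  map f := ⟨fun _ _ x => x.map f, fun _ _ x => x.map_s f, fun _ _ x => x.map_t f⟩
  map_id X := Hom.ext (by funext m h x; cases x <;> rfl)
  map_comp f g := Hom.ext (by funext m h x; cases x <;> rfl)

/-- The inclusion of the cells of a globular set as strings of length one. -/
def singleStr (n i : ℕ) (hi : i ≤ n) : 𝟭 (GSet.{u} n) ⟶ freeStr.{u} n i hi where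
  app X := Hom.mk (X := X) (Y := (freeStr n i hi).obj X) (fun _ _ x => FreeCell.single x)
    (fun _ _ x => FreeCell.single_s x) (fun _ _ x => FreeCell.single_t x)
  naturality X Y f := Hom.ext (by
    funext m h x
    exact (FreeCell.map_single f x).symm)

end GSet

/-! An `n`-graph carries no more information than its cells. Objects are the 0-cells, and an
`(m+1)`-cell records the `A(a, b)` it lives in. Induction on `n` therefore shows that morphisms are
determined by cells (`hom_ext`), that any function on cells respecting sources and targets comes
from a morphism (`exists_hom`), and that every globular set is realized (`exists_realization`: take
the 0-cells as objects, and realize the globular sets of higher cells with fixed 0-dimensional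
source and target). This is the equivalence. It also lets all later constructions be made on cells:
the cells of a product are pairs, so a category enriched in `n`-graphs is a compatible family of
ordinary compositions, one in each dimension (`CellCategory`).

The other two claims go by induction on `i`, with `n` falling in parallel. For `i = 0` the free
category on a graph has as `m`-cells of its hom-graphs the paths of `m`-cells of the `A(a, b)`; a
graph morphism extends by composing along paths (`freeLift`). Monadicity is checked directly with
`comparison_isEquivalence_iff`, not with Beck's theorem: a homomorphism of algebras preserves the
composites of empty paths and of paths of length two, hence is a functor
(`exists_map_eq_of_compat`); an algebra evaluates every path, and its values on those two kinds of
path make up a category that induces the algebra (`exists_eq_counit_of_algebra`). A path of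
`m`-cells of the `A(a, b)` is the same as a string of `(m+1)`-cells of `A` matching along 0-cells
(`freeCell_bijective`).

For the step from `i` to `i + 1`, everything is applied to each `A(a, b)` separately. An adjunction
passes to enriched graphs with its unit and counit taken edgewise. Monadicity passes too, because
the unit law forces an algebra structure to be the identity on objects, so that an algebra is a
family of algebras (`pushforwardAdj_comparison_isEquivalence`). The `(i+1)`-cells along which a
string matches are all parallel, so the whole string lies in a single `A(a, b)`, where it is a
string matching along `i`-cells (`consFree_bijective`). -/

/-! ### Isomorphisms of globular sets, and the globular sets between two 0-cells -/

namespace GSet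

variable {n : ℕ}

/-- A morphism of globular sets that is bijective on cells is an isomorphism. -/
theorem isIso_of_bijective {X Y : GSet.{u} n} (f : X ⟶ Y)
    (hf : ∀ m h, Function.Bijective (GSet.Hom.app f m h)) : IsIso f := by
  let e : ∀ m h, X.cell m h ≃ Y.cell m h := fun m h => Equiv.ofBijective _ (hf m h)
  have he : ∀ m h x, GSet.Hom.app f m h ((e m h).symm x) = x := fun m h x =>
    (e m h).apply_symm_apply x
  have he' : ∀ m h x, (e m h).symm (GSet.Hom.app f m h x) = x := fun m h x =>
    (e m h).symm_apply_apply x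
  let g : Y ⟶ X := GSet.Hom.mk (fun m h => (e m h).symm)
    -- The inverse respects sources because `f` does and is injective one dimension lower; targets
    -- are alike.
    (fun m h x => (hf _ _).1 (by rw [he, GSet.Hom.app_s, he]))
    (fun m h x => (hf _ _).1 (by rw [he, GSet.Hom.app_t, he]))
  exact ⟨g, GSet.Hom.ext (by funext m h x; exact he' m h x),
    GSet.Hom.ext (by funext m h x; exact he m h x)⟩

theorem inv_app_app {X Y : GSet.{u} n} (e : X ≅ Y) {m : ℕ} {h : m ≤ n} (x : X.cell m h) :
    GSet.Hom.app e.inv m h (GSet.Hom.app e.hom m h x) = x :=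
  congrFun (congrFun (congrFun (congrArg GSet.Hom.app e.hom_inv_id) m) h) x

theorem app_inv_app {X Y : GSet.{u} n} (e : X ≅ Y) {m : ℕ} {h : m ≤ n} (x : Y.cell m h) :
    GSet.Hom.app e.hom m h (GSet.Hom.app e.inv m h x) = x :=
  congrFun (congrFun (congrFun (congrArg GSet.Hom.app e.inv_hom_id) m) h) x

theorem app_bijective {X Y : GSet.{u} n} (e : X ≅ Y) (m : ℕ) (h : m ≤ n) :
    Function.Bijective (GSet.Hom.app e.hom m h) :=
  ⟨Function.LeftInverse.injective fun x => inv_app_app e x,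
    Function.RightInverse.surjective fun x => app_inv_app e x⟩

/-- The globular set of the cells of positive dimension with given `0`-dimensional source and
target. -/
def homSet (X : GSet.{u} (n + 1)) (a b : X.cell 0 (Nat.zero_le _)) : GSet.{u} n where
  cell m h := {x : X.cell (m + 1) (Nat.succ_le_succ h) //
    X.srcTo 0 (Nat.zero_le _) (m + 1) (Nat.succ_le_succ h) (Nat.zero_le _) x = a ∧
    X.tgtTo 0 (Nat.zero_le _) (m + 1) (Nat.succ_le_succ h) (Nat.zero_le _) x = b}
  -- The 0-dimensional target survives passage to the source because the cell has dimension at least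
  -- two: there `ts = tt` applies. The field `t` uses `ss = st` in the same way.
  s m h x := ⟨X.s (m + 1) (Nat.succ_le_succ h) x.1,
    (X.srcTo_succ 0 (Nat.zero_le _) (m + 1) (Nat.succ_le_succ h) (Nat.zero_le _) x.1).symm.trans
      x.2.1,
    (X.tgtTo_s 0 (Nat.zero_le _) (m + 1) (Nat.succ_le_succ h) (Nat.succ_pos _) x.1).trans x.2.2⟩
  t m h x := ⟨X.t (m + 1) (Nat.succ_le_succ h) x.1,
    (X.srcTo_t 0 (Nat.zero_le _) (m + 1) (Nat.succ_le_succ h) (Nat.succ_pos _) x.1).trans x.2.1,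
    (X.tgtTo_succ 0 (Nat.zero_le _) (m + 1) (Nat.succ_le_succ h) (Nat.zero_le _) x.1).symm.trans
      x.2.2⟩
  s_s m h x := Subtype.ext (X.s_s (m + 1) (Nat.succ_le_succ h) x.1)
  t_s m h x := Subtype.ext (X.t_s (m + 1) (Nat.succ_le_succ h) x.1)

theorem srcTo_zero_one (X : GSet.{u} n) (h : 1 ≤ n) (x : X.cell 1 h) :
    X.srcTo 0 (Nat.zero_le _) 1 h (Nat.zero_le _) x = X.s 0 h x := by
  rw [X.srcTo_succ 0 (Nat.zero_le _) 0 h le_rfl, srcTo_self]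

theorem tgtTo_zero_one (X : GSet.{u} n) (h : 1 ≤ n) (x : X.cell 1 h) :
    X.tgtTo 0 (Nat.zero_le _) 1 h (Nat.zero_le _) x = X.t 0 h x := by
  rw [X.tgtTo_succ 0 (Nat.zero_le _) 0 h le_rfl, tgtTo_self]

end GSet

/-! ### The equivalence between `n`-graphs and `n`-globular sets -/

namespace NGph

theorem consCell_injective {n m : ℕ} {h : m ≤ n} (A : NGph.{u} (n + 1)) (a b : VGraph.Obj A) :
    Function.Injective (consCell (h := h) A a b) := fun _ _ hxy =>
  eq_of_heq (Sigma.mk.inj (eq_of_heq (Sigma.mk.inj hxy).2)).2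

/-- Morphisms of `n`-graphs are determined by their action on cells. -/
theorem hom_ext : ∀ {n : ℕ} {A B : NGph.{u} n} {f g : A ⟶ B}
    (_ : ∀ (m : ℕ) (h : m ≤ n) (x : cell n m h A), mapCell n m h f x = mapCell n m h g x), f = g
  | 0, A, B, f, g, H => ConcreteCategory.hom_ext (C := Type u) f g fun x => H 0 le_rfl x
  | n + 1, A, B, f, g, H => by
    change toHom f = toHom g
    change ∀ m h x, mapCell (n + 1) m h (A := A) (B := B) (toHom f) x =
      mapCell (n + 1) m h (A := A) (B := B) (toHom g) x at H
    generalize toHom f = f at *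
    generalize toHom g = g at *
    obtain ⟨fo, fm⟩ := f
    obtain ⟨go, gm⟩ := g
    -- Agreement on 0-cells identifies the object functions, so the edge components become
    -- comparable without transport.
    obtain rfl : fo = go := funext fun a => H 0 (Nat.zero_le _) a
    refine congrArg (VGraph.Hom.mk fo) (funext fun a => funext fun b => ?_)
    refine hom_ext (n := n) fun m h x => ?_
    exact consCell_injective B (fo a) (fo b) (H (m + 1) (Nat.succ_le_succ h) ⟨a, b, x⟩)

/-- The endpoints of the image are controlled by induction on `m`: for a 1-cell they are its source
and target, and a higher cell has the same endpoints as its source. Hence `φ` restricts to each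
`A(a, b)`. -/
theorem eq_consCell_of_src_tgt {n : ℕ} {A B : NGph.{u} (n + 1)}
    (φ : ∀ m h, cell (n + 1) m h A → cell (n + 1) m h B)
    (hs : ∀ m h x, φ m (Nat.le_of_succ_le h) (src (n + 1) m h A x) =
      src (n + 1) m h B (φ (m + 1) h x))
    (ht : ∀ m h x, φ m (Nat.le_of_succ_le h) (tgt (n + 1) m h A x) =
      tgt (n + 1) m h B (φ (m + 1) h x))
    (a b : VGraph.Obj A) : ∀ (m : ℕ) (h : m ≤ n) (x : cell n m h (VGraph.edge A a b)),
    ∃ y : cell n m h (VGraph.edge B (φ 0 (Nat.zero_le _) a) (φ 0 (Nat.zero_le _) b)),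
      φ (m + 1) (Nat.succ_le_succ h) (consCell A a b x) =
        consCell B (φ 0 (Nat.zero_le _) a) (φ 0 (Nat.zero_le _) b) y
  | 0, h, x => by
    have h₁ := hs 0 (Nat.succ_le_succ h) (consCell A a b x)
    have h₂ := ht 0 (Nat.succ_le_succ h) (consCell A a b x)
    generalize φ (0 + 1) (Nat.succ_le_succ h) (consCell A a b x) = z at *
    obtain ⟨c, d, z⟩ := z
    obtain rfl : φ 0 (Nat.zero_le _) a = c := h₁
    obtain rfl : φ 0 (Nat.zero_le _) b = d := h₂
    exact ⟨z, rfl⟩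
  | m + 1, h, x => by
    have h₁ := hs (m + 1) (Nat.succ_le_succ h) (consCell A a b x)
    obtain ⟨y, hy⟩ := eq_consCell_of_src_tgt φ hs ht a b m (Nat.le_of_succ_le h) (src n m h _ x)
    replace h₁ := hy.symm.trans h₁
    generalize φ (m + 1 + 1) (Nat.succ_le_succ h) (consCell A a b x) = z at *
    obtain ⟨c, d, z⟩ := z
    obtain rfl : φ 0 (Nat.zero_le _) a = c := (Sigma.mk.inj h₁).1
    obtain rfl : φ 0 (Nat.zero_le _) b = d := (Sigma.mk.inj (eq_of_heq (Sigma.mk.inj h₁).2)).1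
    exact ⟨z, rfl⟩

/-- Functions on cells that respect sources and targets come from a morphism of `n`-graphs. -/
theorem exists_hom : ∀ {n : ℕ} {A B : NGph.{u} n}
    (φ : ∀ m h, cell n m h A → cell n m h B)
    (_ : ∀ m h x, φ m (Nat.le_of_succ_le h) (src n m h A x) = src n m h B (φ (m + 1) h x))
    (_ : ∀ m h x, φ m (Nat.le_of_succ_le h) (tgt n m h A x) = tgt n m h B (φ (m + 1) h x)),
    ∃ f : A ⟶ B, ∀ m h x, mapCell n m h f x = φ m h x
  | 0, A, B, φ, _, _ => by
    refine ⟨TypeCat.ofHom (φ 0 le_rfl), fun m h x => ?_⟩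
    obtain rfl := Nat.le_zero.1 h
    rfl
  | n + 1, A, B, φ, hs, ht => by
    -- `ψ a b` is the restriction of `φ` to `A(a, b)`. Its compatibility with sources and targets is
    -- that of `φ` one dimension higher, read through the injective `consCell`.
    choose ψ hψ using eq_consCell_of_src_tgt φ hs ht
    have key : ∀ a b, ∃ f : VGraph.edge (V := NGph.{u} n) A a b ⟶
        VGraph.edge (V := NGph.{u} n) B (φ 0 (Nat.zero_le _) a) (φ 0 (Nat.zero_le _) b),
        ∀ m h x, mapCell n m h f x = ψ a b m h x := fun a b => by
      refine exists_hom (ψ a b) (fun m h x => ?_) (fun m h x => ?_)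
      · apply consCell_injective B
        refine (hψ a b m _ _).symm.trans ((hs (m + 1) (Nat.succ_le_succ h)
          (consCell A a b x)).trans ?_)
        rw [hψ]; rfl
      · apply consCell_injective B
        refine (hψ a b m _ _).symm.trans ((ht (m + 1) (Nat.succ_le_succ h)
          (consCell A a b x)).trans ?_)
        rw [hψ]; rfl
    choose f hf using key
    refine ⟨VGraph.Hom.mk (V := NGph.{u} n) (A := A) (B := B) (φ 0 (Nat.zero_le _)) f,
      fun m h x => ?_⟩
    cases m with
    | zero => rfl
    | succ m =>
      obtain ⟨a, b, x⟩ := x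
      refine Eq.trans ?_ (hψ a b m (Nat.le_of_succ_le_succ h) x).symm
      exact congrArg (consCell B _ _) (hf a b m (Nat.le_of_succ_le_succ h) x)

/-- Every globular set is isomorphic to the globular set of cells of an `n`-graph. -/
theorem exists_realization : ∀ {n : ℕ} (X : GSet.{u} n),
    ∃ A : NGph.{u} n, Nonempty ((toGSet n).obj A ≅ X)
  | 0, X => by
    refine ⟨(X.cell 0 le_rfl : Type u), ⟨?_⟩⟩
    let f : (toGSet.{u} 0).obj (X.cell 0 le_rfl : Type u) ⟶ X := GSet.Hom.mk
      (X := (toGSet.{u} 0).obj (X.cell 0 le_rfl : Type u)) (Y := X)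
      (fun m h x => match m, h, x with
        | 0, _, x => x)
      (fun m h => absurd h (Nat.not_succ_le_zero _)) (fun m h => absurd h (Nat.not_succ_le_zero _))
    have := GSet.isIso_of_bijective f fun m h => by
      obtain rfl := Nat.le_zero.1 h
      exact Function.bijective_id
    exact asIso f
  | n + 1, X => by
    -- The graph has the 0-cells of `X` as objects and realizations of the `X.homSet a b` as edges.
    choose E hE using fun a b => exists_realization (X.homSet a b)
    let e := fun a b => (hE a b).some
    let A : NGph.{u} (n + 1) := VGraph.mk (V := NGph.{u} n) (X.cell 0 (Nat.zero_le _)) E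
    let f : (toGSet.{u} (n + 1)).obj A ⟶ X := GSet.Hom.mk
      (X := (toGSet.{u} (n + 1)).obj A) (Y := X)
      (fun m h x => match m, h, x with
        | 0, _, x => x
        | m + 1, h, x =>
          (GSet.Hom.app (e x.1 x.2.1).hom m (Nat.le_of_succ_le_succ h) x.2.2).1)
      (fun m h x => by
        obtain ⟨a, b, x⟩ := x
        cases m with
        | zero =>
          exact (GSet.Hom.app (e a b).hom 0 (Nat.le_of_succ_le_succ h) x).2.1.symm.trans
            (GSet.srcTo_zero_one X h _)
        | succ m =>
          exact congrArg Subtype.val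
            (GSet.Hom.app_s (e a b).hom m (Nat.le_of_succ_le_succ h) x))
      (fun m h x => by
        obtain ⟨a, b, x⟩ := x
        cases m with
        | zero =>
          exact (GSet.Hom.app (e a b).hom 0 (Nat.le_of_succ_le_succ h) x).2.2.symm.trans
            (GSet.tgtTo_zero_one X h _)
        | succ m =>
          exact congrArg Subtype.val
            (GSet.Hom.app_t (e a b).hom m (Nat.le_of_succ_le_succ h) x))
    have := GSet.isIso_of_bijective f fun m h => by
      cases m with
      | zero => exact Function.bijective_id
      | succ m =>
        constructor
        · rintro ⟨a, b, x⟩ ⟨c, d, y⟩ hxy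
          -- The common image in `X` has its 0-dimensional source and target fixed by either
          -- preimage, so both lie over the same pair of objects.
          replace hxy : (GSet.Hom.app (e a b).hom m (Nat.le_of_succ_le_succ h) x).1 =
            (GSet.Hom.app (e c d).hom m (Nat.le_of_succ_le_succ h) y).1 := hxy
          have hx := (GSet.Hom.app (e a b).hom m (Nat.le_of_succ_le_succ h) x).2
          have hy := (GSet.Hom.app (e c d).hom m (Nat.le_of_succ_le_succ h) y).2
          rw [hxy] at hx
          obtain rfl : a = c := hx.1.symm.trans hy.1
          obtain rfl : b = d := hx.2.symm.trans hy.2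
          exact congrArg (consCell A a b) ((GSet.app_bijective (e a b) _ _).1 (Subtype.ext hxy))
        · intro y
          -- The endpoints are left to unification: `y` lies in `homSet` over its own 0-dimensional
          -- source and target.
          obtain ⟨x, hx⟩ := (GSet.app_bijective (e _ _) _ (Nat.le_of_succ_le_succ h)).2
            ⟨y, rfl, rfl⟩
          exact ⟨⟨_, _, x⟩, congrArg Subtype.val hx⟩
    exact ⟨A, ⟨asIso f⟩⟩

theorem toGSet_isEquivalence (n : ℕ) : (toGSet.{u} n).IsEquivalence where
  faithful := ⟨fun {A B f g} h => hom_ext fun m hm x =>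
    congrFun (congrFun (congrFun (congrArg GSet.Hom.app h) m) hm) x⟩
  full := ⟨fun {A B} φ => by
    obtain ⟨f, hf⟩ := exists_hom (GSet.Hom.app φ) (GSet.Hom.app_s φ) (GSet.Hom.app_t φ)
    exact ⟨f, GSet.Hom.ext (by funext m h x; exact hf m h x)⟩⟩
  essSurj := ⟨fun X => exists_realization X⟩

end NGph

/-! ### Products of `n`-graphs, cell by cell -/

namespace NGph

open SemiCartesianMonoidalCategory (fst snd)

/-- The cells of a product of `n`-graphs are the pairs of cells. -/
theorem cell_tensor_bijective : ∀ {n : ℕ} (A B : NGph.{u} n) (m : ℕ) (h : m ≤ n),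
    Function.Bijective (fun x : cell n m h (A ⊗ B) =>
      (mapCell n m h (fst A B) x, mapCell n m h (snd A B) x))
  | 0, A, B, m, h => by
    obtain rfl := Nat.le_zero.1 h
    exact Function.bijective_id
  | n + 1, A, B, 0, h => Function.bijective_id
  | n + 1, A, B, m + 1, h => by
    constructor
    · rintro ⟨⟨a, a'⟩, ⟨b, b'⟩, x⟩ ⟨⟨c, c'⟩, ⟨d, d'⟩, y⟩ hxy
      have h₁ := (Prod.mk.inj hxy).1
      have h₂ := (Prod.mk.inj hxy).2
      obtain rfl : a = c := (Sigma.mk.inj h₁).1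
      obtain rfl : b = d := (Sigma.mk.inj (eq_of_heq (Sigma.mk.inj h₁).2)).1
      obtain rfl : a' = c' := (Sigma.mk.inj h₂).1
      obtain rfl : b' = d' := (Sigma.mk.inj (eq_of_heq (Sigma.mk.inj h₂).2)).1
      refine congrArg (consCell (A ⊗ B) (a, a') (b, b')) ?_
      exact (cell_tensor_bijective _ _ m (Nat.le_of_succ_le_succ h)).1
        (Prod.ext (consCell_injective A a b h₁) (consCell_injective B a' b' h₂))
    · rintro ⟨⟨a, b, x⟩, ⟨a', b', y⟩⟩
      obtain ⟨z, hz⟩ := (cell_tensor_bijective _ _ m (Nat.le_of_succ_le_succ h)).2 (x, y)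
      exact ⟨consCell (A ⊗ B) (a, a') (b, b') z,
        Prod.ext (congrArg (consCell A a b) (Prod.mk.inj hz).1)
          (congrArg (consCell B a' b') (Prod.mk.inj hz).2)⟩

/-- The terminal `n`-graph has one cell in every dimension. -/
theorem nonempty_unique_cell_unit : ∀ (n m : ℕ) (h : m ≤ n),
    Nonempty (Unique (cell n m h (𝟙_ (NGph.{u} n))))
  | 0, m, h => by
    obtain rfl := Nat.le_zero.1 h
    exact ⟨(inferInstance : Unique PUnit)⟩
  | n + 1, 0, h => ⟨(inferInstance : Unique PUnit)⟩
  | n + 1, m + 1, h => by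
    obtain ⟨hu⟩ := nonempty_unique_cell_unit n m (Nat.le_of_succ_le_succ h)
    refine ⟨⟨⟨consCell (𝟙_ (NGph.{u} (n + 1))) PUnit.unit PUnit.unit hu.default⟩, ?_⟩⟩
    rintro ⟨⟨⟩, ⟨⟩, x⟩
    exact congrArg (consCell (𝟙_ (NGph.{u} (n + 1))) PUnit.unit PUnit.unit) (hu.uniq x)

section

variable {n m : ℕ} {h : m ≤ n} {A B C A' B' : NGph.{u} n}

/-- The cell of the terminal `n`-graph. -/
noncomputable def pt : cell n m h (𝟙_ (NGph.{u} n)) :=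
  (nonempty_unique_cell_unit n m h).some.default

theorem eq_pt (x : cell n m h (𝟙_ (NGph.{u} n))) : x = pt :=
  (nonempty_unique_cell_unit n m h).some.uniq x

/-- A pair of cells as a cell of the product. -/
noncomputable def pair (x : cell n m h A) (y : cell n m h B) : cell n m h (A ⊗ B) :=
  ((cell_tensor_bijective A B m h).2 (x, y)).choose

theorem mapCell_fst_pair (x : cell n m h A) (y : cell n m h B) :
    mapCell n m h (fst A B) (pair x y) = x :=
  congrArg Prod.fst ((cell_tensor_bijective A B m h).2 (x, y)).choose_spec

theorem mapCell_snd_pair (x : cell n m h A) (y : cell n m h B) :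
    mapCell n m h (snd A B) (pair x y) = y :=
  congrArg Prod.snd ((cell_tensor_bijective A B m h).2 (x, y)).choose_spec

theorem pair_ext {z w : cell n m h (A ⊗ B)}
    (h₁ : mapCell n m h (fst A B) z = mapCell n m h (fst A B) w)
    (h₂ : mapCell n m h (snd A B) z = mapCell n m h (snd A B) w) : z = w :=
  (cell_tensor_bijective A B m h).1 (Prod.ext h₁ h₂)

theorem exists_eq_pair (z : cell n m h (A ⊗ B)) : ∃ x y, z = pair x y :=
  ⟨mapCell n m h (fst A B) z, mapCell n m h (snd A B) z,
    pair_ext (mapCell_fst_pair _ _).symm (mapCell_snd_pair _ _).symm⟩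

theorem src_pair {h : m + 1 ≤ n} (x : cell n (m + 1) h A) (y : cell n (m + 1) h B) :
    src n m h (A ⊗ B) (pair x y) = pair (src n m h A x) (src n m h B y) :=
  pair_ext (by rw [mapCell_src, mapCell_fst_pair, mapCell_fst_pair])
    (by rw [mapCell_src, mapCell_snd_pair, mapCell_snd_pair])

theorem tgt_pair {h : m + 1 ≤ n} (x : cell n (m + 1) h A) (y : cell n (m + 1) h B) :
    tgt n m h (A ⊗ B) (pair x y) = pair (tgt n m h A x) (tgt n m h B y) :=
  pair_ext (by rw [mapCell_tgt, mapCell_fst_pair, mapCell_fst_pair])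
    (by rw [mapCell_tgt, mapCell_snd_pair, mapCell_snd_pair])

theorem mapCell_tensorHom_pair (f : A ⟶ A') (g : B ⟶ B') (x : cell n m h A)
    (y : cell n m h B) :
    mapCell n m h (f ⊗ₘ g) (pair x y) = pair (mapCell n m h f x) (mapCell n m h g y) :=
  pair_ext
    (by rw [← mapCell_comp, CartesianMonoidalCategory.tensorHom_fst, mapCell_comp,
      mapCell_fst_pair, mapCell_fst_pair])
    (by rw [← mapCell_comp, CartesianMonoidalCategory.tensorHom_snd, mapCell_comp,
      mapCell_snd_pair, mapCell_snd_pair])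

theorem mapCell_whiskerLeft_pair (g : B ⟶ B') (x : cell n m h A) (y : cell n m h B) :
    mapCell n m h (A ◁ g) (pair x y) = pair x (mapCell n m h g y) := by
  rw [← id_tensorHom, mapCell_tensorHom_pair, mapCell_id]

theorem mapCell_whiskerRight_pair (f : A ⟶ A') (x : cell n m h A) (y : cell n m h B) :
    mapCell n m h (f ▷ B) (pair x y) = pair (mapCell n m h f x) y := by
  rw [← tensorHom_id, mapCell_tensorHom_pair, mapCell_id]

/-- A cell of a product is determined by its projections, and each projection of the associator is a
projection. With the unitor lemmas below, this turns the axioms of enriched categories into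
equations between cells. -/
theorem mapCell_associator_inv (x : cell n m h A) (y : cell n m h B) (z : cell n m h C) :
    mapCell n m h (α_ A B C).inv (pair x (pair y z)) = pair (pair x y) z := by
  refine pair_ext (pair_ext ?_ ?_) ?_
  · rw [← mapCell_comp, ← mapCell_comp, CartesianMonoidalCategory.associator_inv_fst_fst,
      mapCell_fst_pair, mapCell_fst_pair, mapCell_fst_pair]
  · rw [← mapCell_comp, ← mapCell_comp, CartesianMonoidalCategory.associator_inv_fst_snd,
      mapCell_comp, mapCell_snd_pair, mapCell_fst_pair, mapCell_fst_pair, mapCell_snd_pair]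
  · rw [← mapCell_comp, CartesianMonoidalCategory.associator_inv_snd,
      mapCell_comp, mapCell_snd_pair, mapCell_snd_pair, mapCell_snd_pair]

theorem mapCell_leftUnitor_inv (x : cell n m h A) :
    mapCell n m h (λ_ A).inv x = pair pt x :=
  pair_ext ((eq_pt _).trans (eq_pt _).symm)
    (by rw [← mapCell_comp, CartesianMonoidalCategory.leftUnitor_inv_snd, mapCell_id,
      mapCell_snd_pair])

theorem mapCell_rightUnitor_inv (x : cell n m h A) :
    mapCell n m h (ρ_ A).inv x = pair x pt :=
  pair_ext (by rw [← mapCell_comp, CartesianMonoidalCategory.rightUnitor_inv_fst, mapCell_id,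
      mapCell_fst_pair]) ((eq_pt _).trans (eq_pt _).symm)

theorem hom_ext_tensor {f g : A ⊗ B ⟶ C} (H : ∀ (m : ℕ) (h : m ≤ n) (x : cell n m h A)
    (y : cell n m h B), mapCell n m h f (pair x y) = mapCell n m h g (pair x y)) : f = g :=
  hom_ext fun m h z => by
    obtain ⟨x, y, rfl⟩ := exists_eq_pair z
    exact H m h x y

theorem hom_ext_unit {f g : 𝟙_ (NGph.{u} n) ⟶ C}
    (H : ∀ (m : ℕ) (h : m ≤ n), mapCell n m h f pt = mapCell n m h g pt) : f = g :=
  hom_ext fun m h z => by rw [eq_pt z, H]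

/-- A composition of cells that respects sources and targets, as a morphism on the product. -/
theorem exists_hom_tensor (φ : ∀ m h, cell n m h A → cell n m h B → cell n m h C)
    (hs : ∀ m h x y, φ m (Nat.le_of_succ_le h) (src n m h A x) (src n m h B y) =
      src n m h C (φ (m + 1) h x y))
    (ht : ∀ m h x y, φ m (Nat.le_of_succ_le h) (tgt n m h A x) (tgt n m h B y) =
      tgt n m h C (φ (m + 1) h x y)) :
    ∃ f : A ⊗ B ⟶ C, ∀ m h x y, mapCell n m h f (pair x y) = φ m h x y := by
  obtain ⟨f, hf⟩ := exists_hom (A := A ⊗ B) (B := C)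
    (fun m h z => φ m h (mapCell n m h (fst A B) z) (mapCell n m h (snd A B) z))
    (fun m h z => by rw [mapCell_src, mapCell_src, hs])
    (fun m h z => by rw [mapCell_tgt, mapCell_tgt, ht])
  exact ⟨f, fun m h x y => by rw [hf, mapCell_fst_pair, mapCell_snd_pair]⟩

/-- The terminal `n`-graph has one cell in each dimension, so a compatible choice of cells of `C` is
already a function on cells. It supplies the enriched identities. -/
theorem exists_hom_unit (φ : ∀ m h, cell n m h C)
    (hs : ∀ m h, φ m (Nat.le_of_succ_le h) = src n m h C (φ (m + 1) h))
    (ht : ∀ m h, φ m (Nat.le_of_succ_le h) = tgt n m h C (φ (m + 1) h)) :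
    ∃ f : 𝟙_ (NGph.{u} n) ⟶ C, ∀ m h, mapCell n m h f pt = φ m h := by
  obtain ⟨f, hf⟩ := exists_hom (A := 𝟙_ (NGph.{u} n)) (B := C) (fun m h _ => φ m h)
    (fun m h _ => hs m h) (fun m h _ => ht m h)
  exact ⟨f, fun m h => hf m h pt⟩

end

/-- An `n`-graph whose globular set of cells is isomorphic to `X`. -/
noncomputable def realize {n : ℕ} (X : GSet.{u} n) : NGph.{u} n := (exists_realization X).choose

/-- The cells of `realize X`. -/
noncomputable def realizeIso {n : ℕ} (X : GSet.{u} n) : (toGSet n).obj (realize X) ≅ X :=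
  (exists_realization X).choose_spec.some

/-- The cells of `realize X`. -/
noncomputable def realizeCell {n : ℕ} (X : GSet.{u} n) (m : ℕ) (h : m ≤ n) :
    cell n m h (realize X) ≃ X.cell m h :=
  Equiv.ofBijective _ (GSet.app_bijective (realizeIso X) m h)

theorem realizeCell_src {n : ℕ} (X : GSet.{u} n) (m : ℕ) (h : m + 1 ≤ n)
    (x : cell n (m + 1) h (realize X)) :
    realizeCell X m (Nat.le_of_succ_le h) (src n m h _ x) = X.s m h (realizeCell X (m + 1) h x) :=
  GSet.Hom.app_s (realizeIso X).hom m h x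

theorem realizeCell_tgt {n : ℕ} (X : GSet.{u} n) (m : ℕ) (h : m + 1 ≤ n)
    (x : cell n (m + 1) h (realize X)) :
    realizeCell X m (Nat.le_of_succ_le h) (tgt n m h _ x) = X.t m h (realizeCell X (m + 1) h x) :=
  GSet.Hom.app_t (realizeIso X).hom m h x

theorem src_realizeCell_symm {n : ℕ} (X : GSet.{u} n) (m : ℕ) (h : m + 1 ≤ n)
    (x : X.cell (m + 1) h) :
    src n m h _ ((realizeCell X (m + 1) h).symm x) =
      (realizeCell X m (Nat.le_of_succ_le h)).symm (X.s m h x) := by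
  rw [Equiv.eq_symm_apply, realizeCell_src, Equiv.apply_symm_apply]

theorem tgt_realizeCell_symm {n : ℕ} (X : GSet.{u} n) (m : ℕ) (h : m + 1 ≤ n)
    (x : X.cell (m + 1) h) :
    tgt n m h _ ((realizeCell X (m + 1) h).symm x) =
      (realizeCell X m (Nat.le_of_succ_le h)).symm (X.t m h x) := by
  rw [Equiv.eq_symm_apply, realizeCell_tgt, Equiv.apply_symm_apply]

end NGph

/-! ### Paths -/

/-- Paths of edges in a family of types. -/
inductive EdgePath {O : Type u} (H : O → O → Type u) : O → O → Type u
  | nil (a : O) : EdgePath H a a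
  | cons {a b c : O} (x : H a b) (p : EdgePath H b c) : EdgePath H a c

namespace EdgePath

variable {O O' : Type u} {H : O → O → Type u} {H' : O' → O' → Type u}

/-- The path of length one on an edge. -/
def single {a b : O} (x : H a b) : EdgePath H a b := cons x (nil b)

/-- The concatenation of paths. -/
def append {a b c : O} : EdgePath H a b → EdgePath H b c → EdgePath H a c
  | nil _, q => q
  | cons x p, q => cons x (append p q)

theorem append_nil {a b : O} (p : EdgePath H a b) : p.append (nil b) = p := by
  induction p with
  | nil => rfl
  | cons x p ih => exact congrArg (cons x) ih

theorem append_assoc {a b c d : O} (p : EdgePath H a b) (q : EdgePath H b c)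
    (r : EdgePath H c d) : (p.append q).append r = p.append (q.append r) := by
  induction p with
  | nil => rfl
  | cons x p ih => exact congrArg (cons x) (ih q)

/-- The image of a path. -/
def map (f : O → O') (g : ∀ a b, H a b → H' (f a) (f b)) {a b : O} :
    EdgePath H a b → EdgePath H' (f a) (f b)
  | nil a => nil (f a)
  | cons x p => cons (g _ _ x) (map f g p)

theorem map_append (f : O → O') (g : ∀ a b, H a b → H' (f a) (f b)) {a b c : O}
    (p : EdgePath H a b) (q : EdgePath H b c) :
    (p.append q).map f g = (p.map f g).append (q.map f g) := by
  induction p with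
  | nil => rfl
  | cons x p ih => exact congrArg (cons _) (ih q)

theorem map_map {O'' : Type u} {H'' : O'' → O'' → Type u} (f : O → O')
    (g : ∀ a b, H a b → H' (f a) (f b)) (f' : O' → O'') (g' : ∀ a b, H' a b → H'' (f' a) (f' b))
    {a b : O} (p : EdgePath H a b) :
    (p.map f g).map f' g' = p.map (fun a => f' (f a)) (fun _ _ x => g' _ _ (g _ _ x)) := by
  induction p with
  | nil => rfl
  | cons x p ih => exact congrArg (cons _) ih

/-- The concatenation of a path of paths. -/
def join {a b : O} : EdgePath (EdgePath H) a b → EdgePath H a b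
  | nil a => nil a
  | cons p q => append p (join q)

end EdgePath

namespace VGraph

/-- With the object function shared by both sides, equality of graph morphisms can be read edge by
edge with no cast. -/
theorem map_congr {V : Type (u + 1)} [Category.{u} V] {A B : VGraph.{u} V} {f : A.Obj → B.Obj}
    {m m' : ∀ a b : A.Obj, A.edge a b ⟶ B.edge (f a) (f b)}
    (h : (Hom.mk f m : A ⟶ B) = Hom.mk f m') (a b : A.Obj) : m a b = m' a b :=
  congrFun (congrFun (eq_of_heq (Hom.mk.inj h).2) a) b

end VGraph

/-! ### Categories enriched in `n`-graphs as compositions of cells -/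

open NGph

/-- A composition of the cells of a family of `n`-graphs that respects sources and targets. -/
structure CellCategory {n : ℕ} {O : Type u} (E : O → O → NGph.{u} n) where
  /-- the composite of two cells -/
  comp : ∀ {m : ℕ} {h : m ≤ n} {a b c : O}, cell n m h (E a b) → cell n m h (E b c) →
    cell n m h (E a c)
  /-- the identity cells -/
  one : ∀ (m : ℕ) (h : m ≤ n) (a : O), cell n m h (E a a)
  src_comp : ∀ {m : ℕ} {h : m + 1 ≤ n} {a b c : O} (x : cell n (m + 1) h (E a b))
    (y : cell n (m + 1) h (E b c)), src n m h _ (comp x y) = comp (src n m h _ x) (src n m h _ y)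
  tgt_comp : ∀ {m : ℕ} {h : m + 1 ≤ n} {a b c : O} (x : cell n (m + 1) h (E a b))
    (y : cell n (m + 1) h (E b c)), tgt n m h _ (comp x y) = comp (tgt n m h _ x) (tgt n m h _ y)
  src_one : ∀ (m : ℕ) (h : m + 1 ≤ n) (a : O),
    src n m h _ (one (m + 1) h a) = one m (Nat.le_of_succ_le h) a
  tgt_one : ∀ (m : ℕ) (h : m + 1 ≤ n) (a : O),
    tgt n m h _ (one (m + 1) h a) = one m (Nat.le_of_succ_le h) a
  one_comp : ∀ {m : ℕ} {h : m ≤ n} {a b : O} (x : cell n m h (E a b)), comp (one m h a) x = x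
  comp_one : ∀ {m : ℕ} {h : m ≤ n} {a b : O} (x : cell n m h (E a b)), comp x (one m h b) = x
  assoc : ∀ {m : ℕ} {h : m ≤ n} {a b c d : O} (x : cell n m h (E a b)) (y : cell n m h (E b c))
    (z : cell n m h (E c d)), comp (comp x y) z = comp x (comp y z)

namespace CellCategory

variable {n : ℕ} {O : Type u} {E : O → O → NGph.{u} n} (S : CellCategory E)

theorem exists_comp (a b c : O) : ∃ f : E a b ⊗ E b c ⟶ E a c,
    ∀ m h x y, mapCell n m h f (pair x y) = S.comp x y :=
  exists_hom_tensor (fun _ _ x y => S.comp x y) (fun _ _ x y => (S.src_comp x y).symm)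
    (fun _ _ x y => (S.tgt_comp x y).symm)

theorem exists_one (a : O) : ∃ f : 𝟙_ (NGph.{u} n) ⟶ E a a,
    ∀ m h, mapCell n m h f pt = S.one m h a :=
  exists_hom_unit (fun m h => S.one m h a) (fun m h => (S.src_one m h a).symm)
    (fun m h => (S.tgt_one m h a).symm)

/-- The enriched category with a given composition of cells. -/
noncomputable def toVCat : VCat.{u} (NGph.{u} n) where
  Obj := O
  enriched :=
    { Hom := E
      id := fun a => (S.exists_one a).choose
      comp := fun a b c => (S.exists_comp a b c).choose
      -- On cells the coherence isomorphisms only insert the point or rebracket pairs, so each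
      -- enriched axiom becomes the corresponding law of `S`.
      id_comp := fun a b => hom_ext fun m h x => by
        rw [mapCell_comp, mapCell_comp, mapCell_leftUnitor_inv, mapCell_whiskerRight_pair,
          (S.exists_one a).choose_spec, (S.exists_comp a a b).choose_spec, S.one_comp, mapCell_id]
      comp_id := fun a b => hom_ext fun m h x => by
        rw [mapCell_comp, mapCell_comp, mapCell_rightUnitor_inv, mapCell_whiskerLeft_pair,
          (S.exists_one b).choose_spec, (S.exists_comp a b b).choose_spec, S.comp_one, mapCell_id]
      assoc := fun a b c d => hom_ext_tensor fun m h x z => by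
        obtain ⟨y, z, rfl⟩ := exists_eq_pair z
        rw [mapCell_comp, mapCell_comp, mapCell_associator_inv, mapCell_whiskerRight_pair,
          (S.exists_comp a b c).choose_spec, (S.exists_comp a c d).choose_spec, mapCell_comp,
          mapCell_whiskerLeft_pair, (S.exists_comp b c d).choose_spec,
          (S.exists_comp a b d).choose_spec, S.assoc] }

end CellCategory

namespace VCat

variable {n : ℕ}

/-- The `n`-graph of morphisms between two objects. -/
abbrev hom (C : VCat.{u} (NGph.{u} n)) (a b : C.Obj) : NGph.{u} n := EnrichedCategory.Hom a b

variable {C D : VCat.{u} (NGph.{u} n)} {m : ℕ} {h : m ≤ n}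

/-- The composite of two cells of a category enriched in `n`-graphs. -/
noncomputable def cellComp {a b c : C.Obj} (x : cell n m h (C.hom a b))
    (y : cell n m h (C.hom b c)) : cell n m h (C.hom a c) :=
  mapCell n m h (eComp (NGph.{u} n) a b c) (pair x y)

/-- The identity cells of a category enriched in `n`-graphs. -/
noncomputable def cellOne (m : ℕ) (h : m ≤ n) (a : C.Obj) : cell n m h (C.hom a a) :=
  mapCell n m h (eId (NGph.{u} n) a) pt

/-- This and the next two laws are the enriched axioms evaluated at cells. -/
theorem cellComp_one {a b : C.Obj} (x : cell n m h (C.hom a b)) :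
    cellComp x (cellOne m h b) = x := by
  have := congrArg (fun f => mapCell n m h f x) (e_comp_id (NGph.{u} n) a b)
  simp only [mapCell_comp, mapCell_rightUnitor_inv, mapCell_whiskerLeft_pair, mapCell_id] at this
  exact this

theorem one_cellComp {a b : C.Obj} (x : cell n m h (C.hom a b)) :
    cellComp (cellOne m h a) x = x := by
  have := congrArg (fun f => mapCell n m h f x) (e_id_comp (NGph.{u} n) a b)
  simp only [mapCell_comp, mapCell_leftUnitor_inv, mapCell_whiskerRight_pair, mapCell_id] at this
  exact this

theorem cellComp_assoc {a b c d : C.Obj} (x : cell n m h (C.hom a b))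
    (y : cell n m h (C.hom b c)) (z : cell n m h (C.hom c d)) :
    cellComp (cellComp x y) z = cellComp x (cellComp y z) := by
  have := congrArg (fun f => mapCell n m h f (pair x (pair y z))) (e_assoc (NGph.{u} n) a b c d)
  simp only [mapCell_comp, mapCell_associator_inv, mapCell_whiskerRight_pair,
    mapCell_whiskerLeft_pair] at this
  exact this

theorem src_cellComp {h : m + 1 ≤ n} {a b c : C.Obj} (x : cell n (m + 1) h (C.hom a b))
    (y : cell n (m + 1) h (C.hom b c)) :
    src n m h _ (cellComp x y) = cellComp (src n m h _ x) (src n m h _ y) := by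
  rw [cellComp, ← mapCell_src, src_pair, cellComp]

theorem tgt_cellComp {h : m + 1 ≤ n} {a b c : C.Obj} (x : cell n (m + 1) h (C.hom a b))
    (y : cell n (m + 1) h (C.hom b c)) :
    tgt n m h _ (cellComp x y) = cellComp (tgt n m h _ x) (tgt n m h _ y) := by
  rw [cellComp, ← mapCell_tgt, tgt_pair, cellComp]

/-- The identity is a morphism out of the terminal `n`-graph, in which the source of the only
`(m+1)`-cell is the only `m`-cell. -/
theorem src_cellOne (m : ℕ) (h : m + 1 ≤ n) (a : C.Obj) :
    src n m h _ (cellOne (m + 1) h a) = cellOne m (Nat.le_of_succ_le h) a := by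
  rw [cellOne, ← mapCell_src, eq_pt (src _ _ _ _ _), cellOne]

theorem tgt_cellOne (m : ℕ) (h : m + 1 ≤ n) (a : C.Obj) :
    tgt n m h _ (cellOne (m + 1) h a) = cellOne m (Nat.le_of_succ_le h) a := by
  rw [cellOne, ← mapCell_tgt, eq_pt (tgt _ _ _ _ _), cellOne]

theorem cellComp_toVCat {O : Type u} {E : O → O → NGph.{u} n} (S : CellCategory E) {a b c : O}
    (x : cell n m h (E a b)) (y : cell n m h (E b c)) :
    cellComp (C := S.toVCat) x y = S.comp x y :=
  (S.exists_comp a b c).choose_spec m h x y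

theorem cellOne_toVCat {O : Type u} {E : O → O → NGph.{u} n} (S : CellCategory E) (a : O) :
    cellOne (C := S.toVCat) m h a = S.one m h a :=
  (S.exists_one a).choose_spec m h

/-- A morphism of graphs that preserves identities and composites of cells, as an enriched
functor. -/
def homMk (f : (forget (NGph.{u} n)).obj C ⟶ (forget (NGph.{u} n)).obj D)
    (h₁ : ∀ m h (a : C.Obj), mapCell n m h (VGraph.Hom.map f a a) (cellOne m h a) =
      cellOne (C := D) m h (VGraph.Hom.obj f a))
    (h₂ : ∀ m h (a b c : C.Obj) (x : cell n m h (C.hom a b)) (y : cell n m h (C.hom b c)),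
      mapCell n m h (VGraph.Hom.map f a c) (cellComp x y) =
        cellComp (C := D) (mapCell n m h (VGraph.Hom.map f a b) x)
          (mapCell n m h (VGraph.Hom.map f b c) y)) : C ⟶ D :=
  EnrichedFunctor.mk (C := C.Obj) (D := D.Obj) (VGraph.Hom.obj f) (VGraph.Hom.map f)
    (fun a => hom_ext_unit fun m h => (mapCell_comp n m h _ _ _).trans (h₁ m h a))
    (fun a b c => hom_ext_tensor fun m h x y => (mapCell_comp n m h _ _ _).trans
      ((h₂ m h a b c x y).trans ((congrArg (mapCell n m h _)
        (mapCell_tensorHom_pair (VGraph.Hom.map f a b) (VGraph.Hom.map f b c) x y).symm).trans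
          (mapCell_comp n m h _ _ _).symm)))

/-- The graph morphism that underlies an enriched functor. -/
abbrev toGraphHom (G : C ⟶ D) :
    VGraph.Hom ((forget (NGph.{u} n)).obj C) ((forget (NGph.{u} n)).obj D) :=
  (forget (NGph.{u} n)).map G

theorem mapCell_cellOne (G : C ⟶ D) (a : C.Obj) :
    mapCell n m h ((toGraphHom G).map a a) (cellOne m h a) =
      cellOne (C := D) m h ((toGraphHom G).obj a) :=
  (mapCell_comp n m h _ _ _).symm.trans
    (congrArg (fun f => mapCell n m h f pt) (EnrichedFunctor.map_id (V := NGph.{u} n) G a))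

theorem mapCell_cellComp (G : C ⟶ D) {a b c : C.Obj} (x : cell n m h (C.hom a b))
    (y : cell n m h (C.hom b c)) :
    mapCell n m h ((toGraphHom G).map a c) (cellComp x y) =
      cellComp (C := D) (mapCell n m h ((toGraphHom G).map a b) x)
        (mapCell n m h ((toGraphHom G).map b c) y) := by
  have := congrArg (fun f => mapCell n m h f (pair x y))
    (EnrichedFunctor.map_comp (V := NGph.{u} n) G a b c)
  simp only [mapCell_comp, mapCell_tensorHom_pair] at this
  exact this

/-- The fields of an enriched functor beyond its graph morphism are propositions. -/
theorem forget_faithful : (forget.{u} (NGph.{u} n)).Faithful where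
  map_injective {C D F G} hFG := by
    obtain ⟨fo, fm, _, _⟩ := F
    obtain ⟨go, gm, _, _⟩ := G
    obtain rfl : fo = go := (VGraph.Hom.mk.inj hFG).1
    obtain rfl : fm = gm := eq_of_heq (VGraph.Hom.mk.inj hFG).2
    rfl

/-- The composite of the cells of a path in a category enriched in `n`-graphs. -/
noncomputable def fold {A : VGraph.{u} (NGph.{u} n)} (f : A ⟶ (forget (NGph.{u} n)).obj C)
    {a b : A.Obj} : EdgePath (fun a b => cell n m h (A.edge a b)) a b →
      cell n m h (C.hom (VGraph.Hom.obj f a) (VGraph.Hom.obj f b))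
  | .nil a => cellOne m h (VGraph.Hom.obj f a)
  | .cons x p => cellComp (mapCell n m h (VGraph.Hom.map f _ _) x) (fold f p)

variable {A : VGraph.{u} (NGph.{u} n)}

theorem fold_append (f : A ⟶ (forget (NGph.{u} n)).obj C)
    {a b c : A.Obj} (p : EdgePath (fun a b => cell n m h (A.edge a b)) a b)
    (q : EdgePath (fun a b => cell n m h (A.edge a b)) b c) :
    fold f (p.append q) = cellComp (fold f p) (fold f q) := by
  induction p with
  | nil => exact (one_cellComp _).symm
  | cons x p ih => exact (congrArg (cellComp _) (ih q)).trans (cellComp_assoc _ _ _).symm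

/-- Sources commute with `f`, with composition and with identities, hence with folding. Together
with `tgt_fold` this makes folding a morphism of `n`-graphs on paths. -/
theorem src_fold {h : m + 1 ≤ n} (f : A ⟶ (forget (NGph.{u} n)).obj C)
    {a b : A.Obj} (p : EdgePath (fun a b => cell n (m + 1) h (A.edge a b)) a b) :
    src n m h _ (fold f p) = fold f (p.map (H' := fun a b => cell n m (Nat.le_of_succ_le h)
      (A.edge a b)) (fun a => a) (fun _ _ => src n m h _)) := by
  induction p with
  | nil => exact src_cellOne _ _ _
  | cons x p ih =>
    exact (src_cellComp _ _).trans (congrArg₂ cellComp (mapCell_src n m h _ _).symm ih)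

theorem tgt_fold {h : m + 1 ≤ n} (f : A ⟶ (forget (NGph.{u} n)).obj C)
    {a b : A.Obj} (p : EdgePath (fun a b => cell n (m + 1) h (A.edge a b)) a b) :
    tgt n m h _ (fold f p) = fold f (p.map (H' := fun a b => cell n m (Nat.le_of_succ_le h)
      (A.edge a b)) (fun a => a) (fun _ _ => tgt n m h _)) := by
  induction p with
  | nil => exact tgt_cellOne _ _ _
  | cons x p ih =>
    exact (tgt_cellComp _ _).trans (congrArg₂ cellComp (mapCell_tgt n m h _ _).symm ih)

end VCat

/-! ### The free category on a graph enriched in `n`-graphs -/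

namespace VCat

variable {n : ℕ}

section

variable (A : VGraph.{u} (NGph.{u} n))

/-- The globular set of paths of cells between two objects of a graph enriched in `n`-graphs. -/
def pathSet (a b : A.Obj) : GSet.{u} n where
  cell m h := EdgePath (fun a b => cell n m h (A.edge a b)) a b
  s m h p := p.map (fun a => a) (fun _ _ => src n m h _)
  t m h p := p.map (fun a => a) (fun _ _ => tgt n m h _)
  s_s m h p := by
    induction p with
    | nil => rfl
    | cons x p ih => exact congrArg₂ EdgePath.cons (src_src n m h _ x) ih
  t_s m h p := by
    induction p with
    | nil => rfl
    | cons x p ih => exact congrArg₂ EdgePath.cons (tgt_src n m h _ x) ih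

/-- The `n`-graph of paths between two objects of a graph enriched in `n`-graphs. -/
noncomputable def pathHom (a b : A.Obj) : NGph.{u} n := realize (pathSet A a b)

variable {A}

/-- The cells of `pathHom A a b` are paths of cells. -/
noncomputable def pathCell {m : ℕ} {h : m ≤ n} {a b : A.Obj} :
    cell n m h (pathHom A a b) ≃ EdgePath (fun a b => cell n m h (A.edge a b)) a b :=
  realizeCell (pathSet A a b) m h

theorem pathCell_src {m : ℕ} {h : m + 1 ≤ n} {a b : A.Obj}
    (x : cell n (m + 1) h (pathHom A a b)) :
    pathCell (src n m h _ x) = (pathCell x).map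
      (H' := fun a b => cell n m (Nat.le_of_succ_le h) (A.edge a b))
      (fun a => a) (fun _ _ => src n m h _) :=
  realizeCell_src (pathSet A a b) m h x

theorem pathCell_tgt {m : ℕ} {h : m + 1 ≤ n} {a b : A.Obj}
    (x : cell n (m + 1) h (pathHom A a b)) :
    pathCell (tgt n m h _ x) = (pathCell x).map
      (H' := fun a b => cell n m (Nat.le_of_succ_le h) (A.edge a b))
      (fun a => a) (fun _ _ => tgt n m h _) :=
  realizeCell_tgt (pathSet A a b) m h x

variable (A)

/-- The concatenation of paths of cells. -/
noncomputable def pathCategory : CellCategory (pathHom A) where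
  comp x y := pathCell.symm ((pathCell x).append (pathCell y))
  one m h a := pathCell.symm (.nil a)
  src_comp x y := by
    rw [Equiv.eq_symm_apply, pathCell_src, pathCell_src, pathCell_src, Equiv.apply_symm_apply]
    exact EdgePath.map_append _ _ _ _
  tgt_comp x y := by
    rw [Equiv.eq_symm_apply, pathCell_tgt, pathCell_tgt, pathCell_tgt, Equiv.apply_symm_apply]
    exact EdgePath.map_append _ _ _ _
  src_one m h a := by
    rw [Equiv.eq_symm_apply, pathCell_src, Equiv.apply_symm_apply]
    rfl
  tgt_one m h a := by
    rw [Equiv.eq_symm_apply, pathCell_tgt, Equiv.apply_symm_apply]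
    rfl
  one_comp x := by
    rw [Equiv.symm_apply_eq, Equiv.apply_symm_apply]
    rfl
  comp_one x := by
    rw [Equiv.symm_apply_eq, Equiv.apply_symm_apply]
    exact EdgePath.append_nil _
  assoc x y z := by
    rw [Equiv.apply_symm_apply, Equiv.apply_symm_apply, EdgePath.append_assoc]

/-- The free category on a graph enriched in `n`-graphs. -/
noncomputable def free : VCat.{u} (NGph.{u} n) := (pathCategory A).toVCat

theorem pathCell_cellComp {m : ℕ} {h : m ≤ n} {a b c : A.Obj} (x : cell n m h (pathHom A a b))
    (y : cell n m h (pathHom A b c)) :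
    pathCell (cellComp (C := free A) x y) = (pathCell x).append (pathCell y) :=
  (congrArg pathCell (cellComp_toVCat (pathCategory A) x y)).trans (Equiv.apply_symm_apply _ _)

theorem pathCell_cellOne {m : ℕ} {h : m ≤ n} (a : A.Obj) :
    pathCell (cellOne (C := free A) m h a) = EdgePath.nil (O := A.Obj) a :=
  (congrArg pathCell (cellOne_toVCat (pathCategory A) a)).trans (Equiv.apply_symm_apply _ _)

theorem exists_freeUnit (a b : A.Obj) : ∃ f : A.edge a b ⟶ pathHom A a b,
    ∀ m h x, mapCell n m h f x = pathCell.symm (EdgePath.single x) :=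
  exists_hom (fun m h x => pathCell.symm (EdgePath.single x))
    (fun m h x => by
      rw [Equiv.symm_apply_eq, pathCell_src, Equiv.apply_symm_apply]
      rfl)
    (fun m h x => by
      rw [Equiv.symm_apply_eq, pathCell_tgt, Equiv.apply_symm_apply]
      rfl)

/-- The inclusion of the cells of a graph as paths of length one. -/
noncomputable def freeUnit : A ⟶ (forget (NGph.{u} n)).obj (free A) :=
  VGraph.Hom.mk (A := A) (B := (forget (NGph.{u} n)).obj (free A)) (fun a => a)
    (fun a b => (exists_freeUnit A a b).choose)

theorem pathCell_freeUnit {m : ℕ} {h : m ≤ n} {a b : A.Obj} (x : cell n m h (A.edge a b)) :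
    pathCell (mapCell n m h (VGraph.Hom.map (freeUnit A) a b) x) = EdgePath.single x :=
  (congrArg pathCell ((exists_freeUnit A a b).choose_spec m h x)).trans
    (Equiv.apply_symm_apply _ _)

end

variable {A B : VGraph.{u} (NGph.{u} n)} {C D : VCat.{u} (NGph.{u} n)}

theorem exists_freeLift (f : A ⟶ (forget (NGph.{u} n)).obj C) (a b : A.Obj) :
    ∃ g : pathHom A a b ⟶ C.hom (VGraph.Hom.obj f a) (VGraph.Hom.obj f b),
      ∀ m h x, mapCell n m h g x = fold f (pathCell x) :=
  exists_hom (fun _ _ x => fold f (pathCell x))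
    (fun _ _ x => (congrArg (fold f) (pathCell_src x)).trans (src_fold f _).symm)
    (fun _ _ x => (congrArg (fold f) (pathCell_tgt x)).trans (tgt_fold f _).symm)

/-- The extension of a morphism of graphs to the free category. -/
noncomputable def freeLift (f : A ⟶ (forget (NGph.{u} n)).obj C) : free A ⟶ C :=
  homMk (VGraph.Hom.mk (A := (forget (NGph.{u} n)).obj (free A))
      (B := (forget (NGph.{u} n)).obj C) (VGraph.Hom.obj (A := A) f)
      (fun a b => (exists_freeLift f a b).choose))
    (fun m h a => ((exists_freeLift f a a).choose_spec m h _).trans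
      (congrArg (fold f) (pathCell_cellOne A a)))
    (fun m h a b c x y => ((exists_freeLift f a c).choose_spec m h _).trans
      ((congrArg (fold f) (pathCell_cellComp A x y)).trans ((fold_append f _ _).trans
        (congrArg₂ cellComp ((exists_freeLift f a b).choose_spec m h x).symm
          ((exists_freeLift f b c).choose_spec m h y).symm))))

theorem mapCell_freeLift (f : A ⟶ (forget (NGph.{u} n)).obj C) {m : ℕ} {h : m ≤ n} {a b : A.Obj}
    (x : cell n m h (pathHom A a b)) :
    mapCell n m h ((toGraphHom (freeLift f)).map a b) x = fold f (pathCell x) :=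
  (exists_freeLift f a b).choose_spec m h x

theorem mapCell_freeLift_symm (f : A ⟶ (forget (NGph.{u} n)).obj C) {m : ℕ} {h : m ≤ n}
    {a b : A.Obj} (p : EdgePath (fun a b => cell n m h (A.edge a b)) a b) :
    mapCell n m h ((toGraphHom (freeLift f)).map a b) (pathCell.symm p) = fold f p :=
  (mapCell_freeLift f _).trans (congrArg (fold f) (Equiv.apply_symm_apply pathCell p))

/-- Folding a path of length one composes its edge with an identity. -/
theorem freeUnit_freeLift (f : A ⟶ (forget (NGph.{u} n)).obj C) :
    freeUnit A ≫ (forget (NGph.{u} n)).map (freeLift f) = f :=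
  congrArg (VGraph.Hom.mk (VGraph.Hom.obj f)) (funext fun _ => funext fun _ =>
    hom_ext fun m h x => (mapCell_comp n m h _ _ _).trans ((mapCell_freeLift f _).trans
      ((congrArg (fold f) (pathCell_freeUnit A x)).trans (cellComp_one _))))

/-- This is the uniqueness half of the universal property: a path is the composite of its edges in
the free category, and `G` preserves composites and identities. -/
theorem fold_freeUnit (G : free A ⟶ C) {m : ℕ} {h : m ≤ n} {a b : A.Obj}
    (p : EdgePath (fun a b => cell n m h (A.edge a b)) a b) :
    fold (freeUnit A ≫ (forget (NGph.{u} n)).map G) p =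
      mapCell n m h ((toGraphHom G).map a b) (pathCell.symm p) := by
  induction p with
  | nil a =>
    refine (mapCell_cellOne G a).symm.trans (congrArg (mapCell n m h _) ?_)
    exact (Equiv.eq_symm_apply _).2 (pathCell_cellOne A a)
  | cons x p ih =>
    refine (congrArg₂ cellComp (mapCell_comp n m h _ _ x) ih).trans
      ((mapCell_cellComp G _ _).symm.trans (congrArg (mapCell n m h _) ?_))
    exact (Equiv.eq_symm_apply _).2 ((pathCell_cellComp A _ _).trans
      (congrArg₂ EdgePath.append (pathCell_freeUnit A x) (Equiv.apply_symm_apply _ p)))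

theorem freeLift_freeUnit (G : free A ⟶ C) :
    freeLift (freeUnit A ≫ (forget (NGph.{u} n)).map G) = G :=
  forget_faithful.map_injective (congrArg (VGraph.Hom.mk (A := (forget (NGph.{u} n)).obj (free A))
    (B := (forget (NGph.{u} n)).obj C) (toGraphHom G).obj)
      (funext fun _ => funext fun _ => hom_ext fun m h x => (mapCell_freeLift _ x).trans
        ((fold_freeUnit G _).trans (congrArg (mapCell n m h _) (Equiv.symm_apply_apply _ x)))))

/-- Enriched functors from the free category on a graph are morphisms of graphs. -/
noncomputable def freeEquiv (A : VGraph.{u} (NGph.{u} n)) (C : VCat.{u} (NGph.{u} n)) :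
    (free A ⟶ C) ≃ (A ⟶ (forget (NGph.{u} n)).obj C) where
  toFun G := freeUnit A ≫ (forget (NGph.{u} n)).map G
  invFun := freeLift
  left_inv := freeLift_freeUnit
  right_inv := freeUnit_freeLift

theorem freeEquiv_comp (A : VGraph.{u} (NGph.{u} n)) (C D : VCat.{u} (NGph.{u} n)) (G : C ⟶ D)
    (H : free A ⟶ C) :
    freeEquiv A D (H ≫ G) = freeEquiv A C H ≫ (forget (NGph.{u} n)).map G :=
  ((congrArg (freeUnit A ≫ ·) ((forget (NGph.{u} n)).map_comp H G))).trans
    (Category.assoc _ _ _).symm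

/-- The free category functor. -/
noncomputable def freeFunctor (n : ℕ) : VGraph.{u} (NGph.{u} n) ⥤ VCat.{u} (NGph.{u} n) :=
  Adjunction.leftAdjointOfEquiv freeEquiv freeEquiv_comp

/-- The free category functor is left adjoint to the forgetful functor. -/
noncomputable def freeAdj (n : ℕ) : freeFunctor.{u} n ⊣ forget.{u} (NGph.{u} n) :=
  Adjunction.adjunctionOfEquivLeft freeEquiv freeEquiv_comp

theorem freeAdj_unit (A : VGraph.{u} (NGph.{u} n)) : (freeAdj n).unit.app A = freeUnit A := by
  refine (Adjunction.adjunctionOfEquivLeft_unit_app freeEquiv freeEquiv_comp A).trans ?_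
  exact (congrArg (freeUnit A ≫ ·) ((forget (NGph.{u} n)).map_id (free A))).trans
    (Category.comp_id _)

theorem freeAdj_counit (C : VCat.{u} (NGph.{u} n)) :
    (freeAdj n).counit.app C = freeLift (𝟙 ((forget (NGph.{u} n)).obj C)) :=
  Adjunction.adjunctionOfEquivLeft_counit_app freeEquiv freeEquiv_comp C

/-- The construction of a left adjoint from hom bijections inserts the transpose of an identity; it
is `freeUnit`. -/
theorem freeFunctor_map (f : A ⟶ B) : (freeFunctor n).map f = freeLift (f ≫ freeUnit B) := by
  refine congrArg (fun g : B ⟶ (forget (NGph.{u} n)).obj (free B) => freeLift (f ≫ g))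
    (a₁ := freeUnit B ≫ (forget (NGph.{u} n)).map (𝟙 (free B))) ?_
  exact (congrArg (freeUnit B ≫ ·) ((forget (NGph.{u} n)).map_id (free B))).trans
    (Category.comp_id _)

end VCat

/-! ### A criterion for monadicity, and its passage to enriched graphs -/

/-- The comparison functor of an adjunction is an equivalence if and only if the right adjoint is
faithful, homomorphisms of algebras between objects in its image lift, and every algebra is
isomorphic to one in its image. -/
theorem comparison_isEquivalence_iff {C D : Type (u + 1)} [Category.{u} C] [Category.{u} D]
    {F : C ⥤ D} {U : D ⥤ C} (adj : F ⊣ U) :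
    (Monad.comparison adj).IsEquivalence ↔ U.Faithful ∧
      (∀ (X Y : D) (f : U.obj X ⟶ U.obj Y),
        U.map (F.map f ≫ adj.counit.app Y) = U.map (adj.counit.app X) ≫ f → ∃ g, U.map g = f) ∧
      ∀ (A : C) (a : U.obj (F.obj A) ⟶ A), adj.unit.app A ≫ a = 𝟙 A →
        U.map (F.map a) ≫ a = U.map (adj.counit.app (F.obj A)) ≫ a →
        ∃ (X : D) (e : U.obj X ≅ A),
          U.map (F.map e.hom) ≫ a = U.map (adj.counit.app X) ≫ e.hom := by
  constructor
  · intro hK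
    refine ⟨Functor.Faithful.of_iso (Monad.comparisonForget adj), fun X Y f hf => ?_,
      fun A a h₁ h₂ => ?_⟩
    · obtain ⟨g, hg⟩ := (Monad.comparison adj).map_surjective
        (X := X) (Y := Y) ⟨f, (U.map_comp _ _).symm.trans hf⟩
      exact ⟨g, congrArg Monad.Algebra.Hom.f hg⟩
    · let X : adj.toMonad.Algebra := ⟨A, a, h₁, h₂.symm⟩
      let e := (Monad.comparison adj).objObjPreimageIso X
      exact ⟨(Monad.comparison adj).objPreimage X, adj.toMonad.forget.mapIso e, e.hom.h⟩
  · rintro ⟨hU, hfull, hess⟩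
    -- Only fullness and essential surjectivity remain: faithfulness of the comparison is inferred
    -- from that of `U`.
    have := hU
    refine { full := ⟨fun {X Y} f => ?_⟩, essSurj := ⟨fun X => ?_⟩ }
    · obtain ⟨g, hg⟩ := hfull X Y f.f ((U.map_comp _ _).trans f.h)
      exact ⟨g, Monad.Algebra.Hom.ext hg⟩
    · obtain ⟨Y, e, he⟩ := hess X.A X.a X.unit X.assoc.symm
      exact ⟨Y, ⟨Monad.Algebra.isoMk e he⟩⟩

namespace VGraph

variable {C D : Type (u + 1)} [Category.{u} C] [Category.{u} D] {F : C ⥤ D} {U : D ⥤ C}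

/-- An adjunction induces an adjunction between the categories of enriched graphs. -/
def pushforwardAdj (adj : F ⊣ U) : pushforward F ⊣ pushforward U where
  unit :=
    { app := fun A => Hom.mk (A := A) (B := (pushforward F ⋙ pushforward U).obj A) (fun a => a)
        (fun a b => adj.unit.app (A.edge a b))
      naturality := fun _ _ f => hom_mk_congr fun a b => adj.unit.naturality (Hom.map f a b) }
  counit :=
    { app := fun A => Hom.mk (A := (pushforward U ⋙ pushforward F).obj A) (B := A) (fun a => a)
        (fun a b => adj.counit.app (A.edge a b))
      naturality := fun _ _ f => hom_mk_congr fun a b => adj.counit.naturality (Hom.map f a b) }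
  left_triangle_components A := hom_mk_congr (A := (pushforward F).obj A)
    (B := (pushforward F).obj A) fun a b => adj.left_triangle_components (A.edge a b)
  right_triangle_components A := hom_mk_congr (A := (pushforward U).obj A)
    (B := (pushforward U).obj A) fun a b => adj.right_triangle_components (A.edge a b)

/-- Isomorphisms of edges give an isomorphism of graphs. -/
def isoMk {O : Type u} {E E' : O → O → C} (e : ∀ a b, E a b ≅ E' a b) :
    VGraph.mk O E ≅ VGraph.mk O E' where
  hom := Hom.mk (A := VGraph.mk O E) (B := VGraph.mk O E') (fun a => a) (fun a b => (e a b).hom)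
  inv := Hom.mk (A := VGraph.mk O E') (B := VGraph.mk O E) (fun a => a) (fun a b => (e a b).inv)
  hom_inv_id := hom_mk_congr (A := VGraph.mk O E) (B := VGraph.mk O E)
    fun a b => (e a b).hom_inv_id
  inv_hom_id := hom_mk_congr (A := VGraph.mk O E') (B := VGraph.mk O E')
    fun a b => (e a b).inv_hom_id

/-- Monadic adjunctions induce monadic adjunctions between categories of enriched graphs. -/
theorem pushforwardAdj_comparison_isEquivalence (adj : F ⊣ U)
    (h : (Monad.comparison adj).IsEquivalence) :
    (Monad.comparison (pushforwardAdj adj)).IsEquivalence := by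
  obtain ⟨hU, hfull, hess⟩ := (comparison_isEquivalence_iff adj).1 h
  refine (comparison_isEquivalence_iff _).2 ⟨⟨fun {A B f g} hfg => ?_⟩, fun A B f hf => ?_,
    fun A a h₁ h₂ => ?_⟩
  · obtain ⟨fo, fm⟩ := f
    obtain ⟨go, gm⟩ := g
    obtain rfl : fo = go := (Hom.mk.inj hfg).1
    exact hom_mk_congr fun a b => hU.map_injective
      (map_congr (A := (pushforward U).obj A) (B := (pushforward U).obj B) hfg a b)
  · choose g hg using fun a b => hfull _ _ (Hom.map f a b)
      (map_congr (A := (pushforward F ⋙ pushforward U).obj ((pushforward U).obj A))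
        (B := (pushforward U).obj B) hf a b)
    exact ⟨Hom.mk (A := A) (B := B) (fun a => Hom.obj (A := (pushforward U).obj A) f a) g,
      hom_mk_congr (A := (pushforward U).obj A) (B := (pushforward U).obj B) hg⟩
  · obtain ⟨ao, am⟩ := a
    -- The unit is the identity on objects, so the unit law makes `a` the identity on objects as
    -- well. It is then a family of algebra structures on the edges, each of which is handled by the
    -- hypothesis on `adj`.
    obtain rfl : ao = fun x => x := (Hom.mk.inj h₁).1
    choose X e he using fun x y => hess (A.edge x y) (am x y) (map_congr h₁ x y)
      (map_congr (A := (pushforward F ⋙ pushforward U).obj ((pushforward F ⋙ pushforward U).obj A))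
        h₂ x y)
    exact ⟨VGraph.mk A.Obj X, isoMk e, hom_mk_congr
      (A := (pushforward F ⋙ pushforward U).obj ((pushforward U).obj (VGraph.mk A.Obj X)))
      (B := A) he⟩

end VGraph

/-! ### Monadicity of the free category adjunction -/

namespace VCat

variable {n : ℕ}

/-- Both sides have transpose `f`. This rewrites the condition on homomorphisms of algebras in terms
of folding. -/
theorem map_freeFunctor_counit {C D : VCat.{u} (NGph.{u} n)}
    (f : (forget (NGph.{u} n)).obj C ⟶ (forget (NGph.{u} n)).obj D) :
    (freeFunctor n).map f ≫ (freeAdj n).counit.app D = freeLift f :=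
  ((freeAdj n).homEquiv_counit _ _ f).symm.trans
    ((Equiv.symm_apply_eq _).2 (((freeAdj n).homEquiv_unit _ _ _).trans
      ((congrArg (· ≫ _) (freeAdj_unit _)).trans (freeUnit_freeLift f))).symm)

/-- The free category functor takes the images of paths. -/
theorem pathCell_fold_comp_freeUnit {A B : VGraph.{u} (NGph.{u} n)} (f : A ⟶ B) {m : ℕ} {h : m ≤ n}
    {a b : A.Obj} (p : EdgePath (fun a b => cell n m h (A.edge a b)) a b) :
    pathCell (fold (C := free B) (f ≫ freeUnit B) p) =
      p.map (H' := fun a b => cell n m h (B.edge a b)) (VGraph.Hom.obj f)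
        (fun _ _ => mapCell n m h (VGraph.Hom.map f _ _)) := by
  induction p with
  | nil a => exact pathCell_cellOne B _
  | cons x p ih =>
    exact (pathCell_cellComp B _ _).trans (congrArg₂ EdgePath.append
      ((congrArg pathCell (mapCell_comp n m h _ _ x)).trans (pathCell_freeUnit B _)) ih)

/-- Composition in the free category is concatenation, so the multiplication of the monad joins a
path of paths. -/
theorem pathCell_fold_id {A : VGraph.{u} (NGph.{u} n)} {m : ℕ} {h : m ≤ n}
    {a b : A.Obj} (p : EdgePath (EdgePath (fun a b => cell n m h (A.edge a b))) a b) :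
    pathCell (A := A) (fold (C := free A) (𝟙 ((forget (NGph.{u} n)).obj (free A)))
      (p.map (H' := fun a b => cell n m h ((free A).hom a b)) (fun a => a)
        (fun _ _ q => pathCell.symm q))) = p.join := by
  induction p with
  | nil a => exact pathCell_cellOne A _
  | cons q p ih =>
    exact (pathCell_cellComp A _ _).trans (congrArg₂ EdgePath.append
      ((congrArg pathCell (mapCell_id n m h _ _)).trans (Equiv.apply_symm_apply _ q)) ih)

/-- On cells the hypothesis says that `f` commutes with the folding of arbitrary paths. Empty paths
give the identities, and paths of length two give the composites. -/
theorem exists_map_eq_of_compat {C D : VCat.{u} (NGph.{u} n)}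
    (f : (forget (NGph.{u} n)).obj C ⟶ (forget (NGph.{u} n)).obj D)
    (hf : (forget (NGph.{u} n)).map (freeLift f) =
      (forget (NGph.{u} n)).map (freeLift (𝟙 ((forget (NGph.{u} n)).obj C))) ≫ f) :
    ∃ g : C ⟶ D, (forget (NGph.{u} n)).map g = f := by
  have key : ∀ (m : ℕ) (h : m ≤ n) (a b : C.Obj)
      (p : EdgePath (fun a b => cell n m h (C.hom a b)) a b),
      fold (A := (forget (NGph.{u} n)).obj C) f p = mapCell n m h (VGraph.Hom.map f a b)
        (fold (𝟙 ((forget (NGph.{u} n)).obj C)) p) := fun m h a b p => by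
    have h₁ := VGraph.map_congr (A := (forget (NGph.{u} n)).obj (free _))
      (B := (forget (NGph.{u} n)).obj D) hf a b
    have h₂ := congrArg (fun g => mapCell n m h g (pathCell.symm p)) h₁
    exact (mapCell_freeLift_symm f p).symm.trans (h₂.trans ((mapCell_comp n m h _ _ _).trans
      (congrArg (mapCell n m h _)
        (mapCell_freeLift_symm (𝟙 ((forget (NGph.{u} n)).obj C)) p))))
  refine ⟨homMk f (fun m h a => (key m h a a (.nil a)).symm) fun m h a b c x y => ?_, rfl⟩
  -- Folding ends with an identity, so the path through `x` and `y` folds to `x (y 1)`; the unit law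
  -- removes the last factor.
  have h₁ := key m h a c (.cons x (.cons y (.nil c)))
  refine Eq.trans (congrArg (mapCell n m h _) ?_) (h₁.symm.trans ?_)
  · exact (congrArg₂ cellComp (mapCell_id n m h _ x) ((cellComp_one _).trans
      (mapCell_id n m h _ y))).symm
  · exact congrArg (cellComp _) (cellComp_one _)

/-- The algebras of the free category monad are categories. -/
theorem exists_eq_counit_of_algebra {A : VGraph.{u} (NGph.{u} n)}
    (a : ∀ x y : A.Obj, pathHom A x y ⟶ A.edge x y)
    (h₁ : ∀ (m : ℕ) (h : m ≤ n) (x y : A.Obj) (z : cell n m h (A.edge x y)),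
      mapCell n m h (a x y) (pathCell.symm (.single z)) = z)
    (h₂ : ∀ (m : ℕ) (h : m ≤ n) (x y : A.Obj)
      (p : EdgePath (EdgePath (fun a b => cell n m h (A.edge a b))) x y),
      mapCell n m h (a x y) (pathCell.symm (p.map (fun x => x)
        (fun _ _ q => mapCell n m h (a _ _) (pathCell.symm q)))) =
          mapCell n m h (a x y) (pathCell.symm p.join)) :
    ∃ S : CellCategory A.edge, ∀ (m : ℕ) (h : m ≤ n) (x y : A.Obj)
      (p : EdgePath (fun a b => cell n m h (A.edge a b)) x y),
      fold (C := S.toVCat) (𝟙 A) p = mapCell n m h (a x y) (pathCell.symm p) := by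
  have h_src : ∀ {m : ℕ} {h : m + 1 ≤ n} {x y : A.Obj}
      (p : EdgePath (fun a b => cell n (m + 1) h (A.edge a b)) x y),
      src n m h _ (mapCell n (m + 1) h (a x y) (pathCell.symm p)) =
        mapCell n m (Nat.le_of_succ_le h) (a x y) (pathCell.symm (p.map
          (H' := fun a b => cell n m (Nat.le_of_succ_le h) (A.edge a b))
          (fun a => a) (fun _ _ => src n m h _))) := fun p =>
    (mapCell_src n _ _ _ _).symm.trans (congrArg _ (src_realizeCell_symm (pathSet A _ _) _ _ p))
  have h_tgt : ∀ {m : ℕ} {h : m + 1 ≤ n} {x y : A.Obj}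
      (p : EdgePath (fun a b => cell n (m + 1) h (A.edge a b)) x y),
      tgt n m h _ (mapCell n (m + 1) h (a x y) (pathCell.symm p)) =
        mapCell n m (Nat.le_of_succ_le h) (a x y) (pathCell.symm (p.map
          (H' := fun a b => cell n m (Nat.le_of_succ_le h) (A.edge a b))
          (fun a => a) (fun _ _ => tgt n m h _))) := fun p =>
    (mapCell_tgt n _ _ _ _).symm.trans (congrArg _ (tgt_realizeCell_symm (pathSet A _ _) _ _ p))
  -- `α` evaluates a path by the algebra structure. The associativity hypothesis lets any subpath be
  -- replaced by its value.
  let α : ∀ {m : ℕ} {h : m ≤ n} {x y : A.Obj},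
      EdgePath (fun a b => cell n m h (A.edge a b)) x y → cell n m h (A.edge x y) :=
    fun {m h x y} p => mapCell n m h (a x y) (pathCell.symm p)
  -- The edge `c` is first rewritten as the value of a path of length one, which gives the path of
  -- paths `(p, [c])`. In `h_right` the path of paths is `([c], p)`.
  have h_left : ∀ {m : ℕ} {h : m ≤ n} {x y z : A.Obj}
      (p : EdgePath (fun a b => cell n m h (A.edge a b)) x y) (c : cell n m h (A.edge y z)),
      α (.cons (α p) (.cons c (.nil z))) = α (p.append (.single c)) := fun {m h x y z} p c =>
    (congrArg (fun d => α (.cons (α p) (.cons d (.nil z)))) (h₁ m h y z c).symm).trans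
      (h₂ m h x z (.cons p (.cons (.single c) (.nil z))))
  have h_right : ∀ {m : ℕ} {h : m ≤ n} {x y z : A.Obj}
      (c : cell n m h (A.edge x y)) (p : EdgePath (fun a b => cell n m h (A.edge a b)) y z),
      α (.cons c (.cons (α p) (.nil z))) = α (.cons c p) := fun {m h x y z} c p =>
    (congrArg (fun d => α (.cons d (.cons (α p) (.nil z)))) (h₁ m h x y c).symm).trans
      ((h₂ m h x z (.cons (.single c) (.cons p (.nil z)))).trans
        (congrArg (fun q => α (.cons c q)) p.append_nil))
  let S : CellCategory A.edge :=
    { comp := fun {_ _ _ _ c} x y => α (.cons x (.cons y (.nil c)))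
      one := fun m h a => α (.nil a)
      src_comp := fun _ _ => h_src _
      tgt_comp := fun _ _ => h_tgt _
      src_one := fun _ _ _ => h_src _
      tgt_one := fun _ _ _ => h_tgt _
      one_comp := fun x => (h_left (.nil _) x).trans (h₁ _ _ _ _ x)
      comp_one := fun x => (h_right x (.nil _)).trans (h₁ _ _ _ _ x)
      -- Both bracketings equal the value of the path with the three edges `x`, `y`, `z`.
      assoc := fun x y z => (h_left (.cons x (.cons y (.nil _))) z).trans
        (h_right x (.cons y (.cons z (.nil _)))).symm }
  refine ⟨S, fun m h x y p => ?_⟩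
  -- Iterated binary composition agrees with `α` on all paths: `h_right` adds one edge at a time.
  induction p with
  | nil b => exact cellOne_toVCat S b
  | cons c p ih =>
    exact (congrArg₂ (cellComp (C := S.toVCat)) (mapCell_id n m h _ c) ih).trans
      ((cellComp_toVCat S _ _).trans (h_right c p))

/-- The abstract conditions of the criterion are made concrete by computing the free functor, the
unit and the counit on paths. -/
theorem freeAdj_comparison_isEquivalence (n : ℕ) :
    (Monad.comparison (freeAdj.{u} n)).IsEquivalence := by
  refine (comparison_isEquivalence_iff _).2 ⟨forget_faithful, fun C D f hf => ?_,
    fun A a h₁ h₂ => ?_⟩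
  · exact exists_map_eq_of_compat f
      ((congrArg (forget (NGph.{u} n)).map (map_freeFunctor_counit f)).symm.trans
        (hf.trans (congrArg (fun g => (forget (NGph.{u} n)).map g ≫ f) (freeAdj_counit C))))
  · obtain ⟨ao, am⟩ := a
    -- The unit law forces `a` to be the identity on objects, as the unit is.
    obtain rfl : ao = fun x => x := (VGraph.Hom.mk.inj h₁).1
    let a : (forget (NGph.{u} n)).obj (free A) ⟶ A := VGraph.Hom.mk (fun x => x) am
    replace h₁ : freeUnit A ≫ a = 𝟙 A := (congrArg (· ≫ a) (freeAdj_unit A)).symm.trans h₁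
    replace h₂ : (forget (NGph.{u} n)).map (freeLift (a ≫ freeUnit A)) ≫ a =
        (forget (NGph.{u} n)).map (freeLift (𝟙 ((forget (NGph.{u} n)).obj (free A)))) ≫ a :=
      (congrArg (fun g => (forget (NGph.{u} n)).map g ≫ a) (freeFunctor_map a)).symm.trans
        (h₂.trans (congrArg (fun g => (forget (NGph.{u} n)).map g ≫ a) (freeAdj_counit (free A))))
    obtain ⟨S, hS⟩ := exists_eq_counit_of_algebra (A := A) am
      (fun m h x y z => by
        have h₃ := congrArg (fun g => mapCell n m h g z)
          (VGraph.map_congr (A := A) (B := A) h₁ x y)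
        refine Eq.trans (congrArg _ ((Equiv.symm_apply_eq _).2 (pathCell_freeUnit A z).symm))
          ((mapCell_comp n m h _ _ z).symm.trans (h₃.trans (mapCell_id n m h _ z))))
      (fun m h x y p => by
        -- The associativity law of the algebra is evaluated at a path of paths: one side applies
        -- `a` to each inner path, the other joins them.
        have h₃ := congrArg (fun g => mapCell n m h g (pathCell.symm (p.map
          (H' := fun a b => cell n m h ((free A).hom a b)) (fun a => a)
            (fun _ _ q => pathCell.symm q))))
          (VGraph.map_congr
            (A := (forget (NGph.{u} n)).obj (free ((forget (NGph.{u} n)).obj (free A))))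
            (B := A) h₂ x y)
        refine Eq.trans (congrArg (mapCell n m h _) ?_) ((mapCell_comp n m h _ _ _).symm.trans
          (h₃.trans ((mapCell_comp n m h _ _ _).trans (congrArg (mapCell n m h _) ?_))))
        · refine Eq.trans ?_ (mapCell_freeLift_symm (a ≫ freeUnit A) _).symm
          exact (Equiv.symm_apply_eq _).2 ((pathCell_fold_comp_freeUnit a _).trans
            (EdgePath.map_map _ _ _ _ p)).symm
        · exact (mapCell_freeLift_symm (𝟙 ((forget (NGph.{u} n)).obj (free A))) _).trans
            ((Equiv.eq_symm_apply _).2 (pathCell_fold_id p)))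
    -- The category built from `S` has `A` itself as underlying graph, so it remains to see that its
    -- counit is `a`.
    refine ⟨S.toVCat, Iso.refl A, ?_⟩
    have h₃ : (forget (NGph.{u} n)).map (freeLift (C := S.toVCat) (𝟙 A)) = a :=
      VGraph.hom_mk_congr (A := (forget (NGph.{u} n)).obj (free A)) (B := A)
        (f := fun x => x) fun x y => hom_ext fun m h z =>
          (mapCell_freeLift _ z).trans ((hS m h x y _).trans
            (congrArg (mapCell n m h _) (Equiv.symm_apply_apply _ z)))
    refine Eq.trans (b := a) ?_ (Eq.trans (b := (forget (NGph.{u} n)).map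
      ((freeAdj n).counit.app S.toVCat)) ?_ (Category.comp_id _).symm)
    · refine Eq.trans (congrArg (fun g => (forget (NGph.{u} n)).map g ≫ a)
        ((freeFunctor n).map_id A)) ?_
      exact (congrArg (· ≫ a) ((forget (NGph.{u} n)).map_id _)).trans (Category.id_comp a)
    · exact h₃.symm.trans (congrArg (forget (NGph.{u} n)).map (freeAdj_counit S.toVCat).symm)

end VCat

/-! ### Equality of free strings -/

namespace GSet

variable {n : ℕ}

theorem FreeCell.s_str {X : GSet.{u} n} {i : ℕ} {hi : i ≤ n} {m : ℕ} {hm : m + 1 ≤ n}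
    {h : i < m + 1} (h' : i < m) (k : ℕ) (w : X.Str i hi (m + 1) hm h k) :
    (FreeCell.str h k w).s = FreeCell.str h' k (w.s h') :=
  dif_pos h'

theorem FreeCell.t_str {X : GSet.{u} n} {i : ℕ} {hi : i ≤ n} {m : ℕ} {hm : m + 1 ≤ n}
    {h : i < m + 1} (h' : i < m) (k : ℕ) (w : X.Str i hi (m + 1) hm h k) :
    (FreeCell.str h k w).t = FreeCell.str h' k (w.t h') :=
  dif_pos h'

theorem FreeCell.s_str_self {X : GSet.{u} n} {i : ℕ} {hi : i ≤ n} {hm : i + 1 ≤ n} {h : i < i + 1}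
    (k : ℕ) (w : X.Str i hi (i + 1) hm h k) :
    (FreeCell.str h k w).s = FreeCell.low le_rfl (w.vertex 0) :=
  dif_neg (lt_irrefl i)

theorem FreeCell.t_str_self {X : GSet.{u} n} {i : ℕ} {hi : i ≤ n} {hm : i + 1 ≤ n} {h : i < i + 1}
    (k : ℕ) (w : X.Str i hi (i + 1) hm h k) :
    (FreeCell.str h k w).t = FreeCell.low le_rfl (w.vertex (Fin.last k)) :=
  dif_neg (lt_irrefl i)

theorem FreeCell.single_of_lt {X : GSet.{u} n} {i : ℕ} {hi : i ≤ n} {m : ℕ} {hm : m ≤ n}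
    (h : i < m) (x : X.cell m hm) :
    (FreeCell.single x : X.FreeCell i hi m hm) = FreeCell.str h 1 (Str.single h x) :=
  dif_pos h

theorem FreeCell.single_of_le {X : GSet.{u} n} {i : ℕ} {hi : i ≤ n} {m : ℕ} {hm : m ≤ n}
    (h : m ≤ i) (x : X.cell m hm) :
    (FreeCell.single x : X.FreeCell i hi m hm) = FreeCell.low h x :=
  dif_neg h.not_gt

/-- Every vertex after the first is the target of an arrow; the first vertex carries independent
information only for the empty string. Lists make strings comparable before their lengths are known
to agree. -/
theorem FreeCell.str_ext {X : GSet.{u} n} {i : ℕ} {hi : i ≤ n} {m : ℕ} {hm : m ≤ n} {h : i < m}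
    {k k' : ℕ} {w : X.Str i hi m hm h k} {w' : X.Str i hi m hm h k'}
    (h₀ : w.vertex 0 = w'.vertex 0) (h₁ : List.ofFn w.arrow = List.ofFn w'.arrow) :
    FreeCell.str h k w = FreeCell.str h k' w' := by
  obtain rfl : k = k' := by simpa using congrArg List.length h₁
  have h₂ : w.arrow = w'.arrow := List.ofFn_injective h₁
  refine congrArg (FreeCell.str h k) (Str.ext (funext fun j => ?_) h₂)
  induction j using Fin.cases with
  | zero => exact h₀
  | succ j => rw [← w.tgt_arrow, ← w'.tgt_arrow, h₂]

theorem FreeCell.str_inj {X : GSet.{u} n} {i : ℕ} {hi : i ≤ n} {m : ℕ} {hm : m ≤ n} {h : i < m}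
    {k k' : ℕ} {w : X.Str i hi m hm h k} {w' : X.Str i hi m hm h k'}
    (hw : FreeCell.str h k w = FreeCell.str h k' w') :
    w.vertex 0 = w'.vertex 0 ∧ List.ofFn w.arrow = List.ofFn w'.arrow := by
  cases hw
  exact ⟨rfl, rfl⟩

end GSet

/-! ### Recognizing free strings, and endpoints of cells -/

namespace NGph

/-- Functions on cells that identify the cells of `T A` with free strings. -/
theorem exists_iso_freeStr {n i : ℕ} (hi : i ≤ n) (T : NGph.{u} n ⥤ NGph.{u} n) (η : 𝟭 _ ⟶ T)
    (ψ : ∀ (A : NGph.{u} n) (m : ℕ) (h : m ≤ n), cell n m h (T.obj A) →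
      ((toGSet n).obj A).FreeCell i hi m h)
    (hψ : ∀ A m h, Function.Bijective (ψ A m h))
    (hs : ∀ A m h x, ψ A m (Nat.le_of_succ_le h) (src n m h _ x) = (ψ A (m + 1) h x).s)
    (ht : ∀ A m h x, ψ A m (Nat.le_of_succ_le h) (tgt n m h _ x) = (ψ A (m + 1) h x).t)
    (hnat : ∀ {A B : NGph.{u} n} (f : A ⟶ B) m h x,
      ψ B m h (mapCell n m h (T.map f) x) = (ψ A m h x).map ((toGSet n).map f))
    (hη : ∀ A m h x, ψ A m h (mapCell n m h (η.app A) x) = GSet.FreeCell.single x) :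
    ∃ φ : T ⋙ toGSet.{u} n ≅ toGSet.{u} n ⋙ GSet.freeStr.{u} n i hi,
      ∀ A : NGph.{u} n, (toGSet.{u} n).map (η.app A) ≫ φ.hom.app A =
        (GSet.singleStr.{u} n i hi).app ((toGSet.{u} n).obj A) := by
  let f : ∀ A, (T ⋙ toGSet.{u} n).obj A ⟶ (toGSet.{u} n ⋙ GSet.freeStr.{u} n i hi).obj A :=
    fun A => GSet.Hom.mk (X := (T ⋙ toGSet.{u} n).obj A)
      (Y := (toGSet.{u} n ⋙ GSet.freeStr.{u} n i hi).obj A) (ψ A) (hs A) (ht A)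
  have hf : ∀ A, IsIso (f A) := fun A => GSet.isIso_of_bijective (f A) (hψ A)
  refine ⟨NatIso.ofComponents (fun A => @asIso _ _ _ _ (f A) (hf A)) fun {A B} g =>
    GSet.Hom.ext ?_, fun A => GSet.Hom.ext ?_⟩
  · funext m h x
    exact hnat g m h x
  · funext m h x
    exact hη A m h x

section

variable {n m : ℕ} {h : m ≤ n} (A : NGph.{u} (n + 1)) (a b : VGraph.Obj A)
  (x : cell n m h (VGraph.edge A a b))

/-- Iterated sources stay inside `A(a, b)` down to dimension one, and the source of a 1-cell there
is `a`. -/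
theorem srcTo_zero_consCell : ∀ {m : ℕ} {h : m ≤ n} (x : cell n m h (VGraph.edge A a b)),
    ((toGSet (n + 1)).obj A).srcTo 0 (Nat.zero_le _) (m + 1) (Nat.succ_le_succ h)
      (Nat.zero_le _) (consCell A a b x) = a
  | 0, _, _ => GSet.srcTo_zero_one _ _ _
  | m + 1, h, x => (GSet.srcTo_succ _ _ _ (m + 1) _ (Nat.zero_le _) _).trans
    (srcTo_zero_consCell (h := Nat.le_of_succ_le h) (src n m h _ x))

theorem tgtTo_zero_consCell : ∀ {m : ℕ} {h : m ≤ n} (x : cell n m h (VGraph.edge A a b)),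
    ((toGSet (n + 1)).obj A).tgtTo 0 (Nat.zero_le _) (m + 1) (Nat.succ_le_succ h)
      (Nat.zero_le _) (consCell A a b x) = b
  | 0, _, _ => GSet.tgtTo_zero_one _ _ _
  | m + 1, h, x => (GSet.tgtTo_succ _ _ _ (m + 1) _ (Nat.zero_le _) _).trans
    (tgtTo_zero_consCell (h := Nat.le_of_succ_le h) (tgt n m h _ x))

end

end NGph

/-! ### Paths as lists of composable edges -/

namespace EdgePath

variable {O : Type u} {H : O → O → Type u}

/-- The number of edges of a path. -/
def length {a b : O} : EdgePath H a b → ℕ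
  | nil _ => 0
  | cons _ p => length p + 1

/-- The vertices of a path. -/
def vertex {a b : O} : (p : EdgePath H a b) → Fin (p.length + 1) → O
  | nil a => fun _ => a
  | @cons _ _ a _ _ _ p => Fin.cons a (vertex p)

/-- The edges of a path. -/
def arrow {a b : O} : (p : EdgePath H a b) → Fin p.length → Σ a b, H a b
  | nil _ => Fin.elim0
  | cons x p => Fin.cons ⟨_, _, x⟩ (arrow p)

/-- The list of the edges of a path. -/
def toList {a b : O} : (p : EdgePath H a b) → List (Σ a b, H a b)
  | nil _ => []
  | cons x p => ⟨_, _, x⟩ :: toList p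

theorem vertex_zero {a b : O} (p : EdgePath H a b) : p.vertex 0 = a := by
  cases p <;> rfl

theorem vertex_last {a b : O} (p : EdgePath H a b) : p.vertex (Fin.last _) = b := by
  induction p with
  | nil => rfl
  | cons x p ih => exact ih

theorem ofFn_arrow {a b : O} (p : EdgePath H a b) : List.ofFn p.arrow = p.toList := by
  induction p with
  | nil => rfl
  | cons x p ih => exact (List.ofFn_cons _ _).trans (congrArg (List.cons _) ih)

theorem arrow_fst {a b : O} (p : EdgePath H a b) (j : Fin p.length) :
    (p.arrow j).1 = p.vertex j.castSucc := by
  induction p with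
  | nil => exact j.elim0
  | cons x p ih =>
    induction j using Fin.cases with
    | zero => rfl
    | succ j => exact ih j

theorem arrow_snd {a b : O} (p : EdgePath H a b) (j : Fin p.length) :
    (p.arrow j).2.1 = p.vertex j.succ := by
  induction p with
  | nil => exact j.elim0
  | cons x p ih =>
    induction j using Fin.cases with
    | zero => exact p.vertex_zero.symm
    | succ j => exact ih j

theorem toList_map {O' : Type u} {H' : O' → O' → Type u} (f : O → O')
    (g : ∀ a b, H a b → H' (f a) (f b)) {a b : O} (p : EdgePath H a b) :
    (p.map f g).toList = p.toList.map fun x => ⟨f x.1, f x.2.1, g _ _ x.2.2⟩ := by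
  induction p with
  | nil => rfl
  | cons x p ih => exact congrArg (List.cons _) ih

/-- Each listed edge carries its endpoints, so the list recovers the path; the starting point
matters only when the list is empty. The dependent pair avoids casting along equalities of
endpoints. -/
theorem eq_of_toList_eq {a b : O} (p : EdgePath H a b) {a' b' : O} (p' : EdgePath H a' b')
    (ha : a = a') (hp : p.toList = p'.toList) :
    (⟨a, b, p⟩ : Σ a b, EdgePath H a b) = ⟨a', b', p'⟩ := by
  induction p generalizing a' b' with
  | nil =>
    cases p' with
    | nil => subst ha; rfl
    | cons => exact absurd hp (List.cons_ne_nil _ _).symm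
  | cons x p ih =>
    cases p' with
    | nil => exact absurd hp (List.cons_ne_nil _ _)
    | cons x' p' =>
      obtain ⟨h₁, h₂⟩ := List.cons.inj hp
      cases h₁
      cases ih p' rfl h₂
      rfl

/-- Composable edges form a path. -/
theorem exists_toList_eq (k : ℕ) (v : Fin (k + 1) → O) (e : Fin k → Σ a b, H a b)
    (h₁ : ∀ j, (e j).1 = v j.castSucc) (h₂ : ∀ j, (e j).2.1 = v j.succ) :
    ∃ (a b : O) (p : EdgePath H a b), a = v 0 ∧ p.toList = List.ofFn e := by
  induction k with
  | zero => exact ⟨v 0, v 0, nil (v 0), rfl, rfl⟩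
  | succ k ih =>
    obtain ⟨a, b, p, ha, hp⟩ := ih (fun j => v j.succ) (fun j => e j.succ) (fun j => h₁ j.succ)
      (fun j => h₂ j.succ)
    have h₃ := h₁ 0
    -- The first edge ends at the vertex with index one, where the path built from the remaining
    -- edges starts.
    have h₄ := (h₂ 0).trans ha.symm
    rw [List.ofFn_succ]
    generalize e 0 = e₀ at h₃ h₄
    obtain ⟨c, d, x⟩ := e₀
    obtain rfl : d = a := h₄
    exact ⟨c, b, cons x p, h₃, congrArg (List.cons _) hp⟩

end EdgePath

/-! ### The cells of the free category -/

namespace VCat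

variable {n m : ℕ} {h : m ≤ n}

/-- A path of cells as a string of cells. -/
def pathStr {A : NGph.{u} (n + 1)} {a b : VGraph.Obj A}
    (p : EdgePath (fun a b => cell n m h (VGraph.edge A a b)) a b) :
    ((toGSet (n + 1)).obj A).Str 0 (Nat.zero_le _) (m + 1) (Nat.succ_le_succ h) (Nat.succ_pos _)
      p.length where
  vertex := p.vertex
  arrow := p.arrow
  src_arrow j := (srcTo_zero_consCell A _ _ (p.arrow j).2.2).trans (p.arrow_fst j)
  tgt_arrow j := (tgtTo_zero_consCell A _ _ (p.arrow j).2.2).trans (p.arrow_snd j)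

/-- The cells of the free category on a graph as strings of cells. -/
noncomputable def freeCell (A : NGph.{u} (n + 1)) : ∀ (m : ℕ) (h : m ≤ n + 1),
    cell (n + 1) m h ((forget (NGph.{u} n)).obj ((freeFunctor n).obj A) : VGraph (NGph.{u} n)) →
      ((toGSet (n + 1)).obj A).FreeCell 0 (Nat.zero_le _) m h
  | 0, _, x => .low le_rfl x
  | m + 1, h, x => .str (Nat.succ_pos _) _
      (pathStr (pathCell (A := A) (m := m) (h := Nat.le_of_succ_le_succ h) x.2.2))

/-- A path of `m`-cells of the `A(a, b)` and a string of `(m+1)`-cells of `A` matching along objects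
are both determined by a starting object and a list of composable edges. -/
theorem freeCell_bijective (A : NGph.{u} (n + 1)) (m : ℕ) (h : m ≤ n + 1) :
    Function.Bijective (freeCell A m h) := by
  cases m with
  | zero =>
    refine ⟨fun x y hxy => (GSet.FreeCell.low.inj hxy), fun y => ?_⟩
    cases y with
    | low h x => exact ⟨x, rfl⟩
    | str h k w => exact absurd h (lt_irrefl _)
  | succ m =>
    constructor
    · rintro ⟨a, b, x⟩ ⟨c, d, y⟩ hxy
      obtain ⟨h₁, h₂⟩ := GSet.FreeCell.str_inj hxy
      have h₃ := EdgePath.eq_of_toList_eq (pathCell (A := A) x) (pathCell (A := A) y)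
        ((EdgePath.vertex_zero _).symm.trans (h₁.trans (EdgePath.vertex_zero _)))
        ((EdgePath.ofFn_arrow _).symm.trans (h₂.trans (EdgePath.ofFn_arrow _)))
      have h₄ := congrArg (fun z : Σ a b, EdgePath (fun a b =>
        cell n m (Nat.le_of_succ_le_succ h) (VGraph.edge A a b)) a b =>
          (⟨z.1, z.2.1, pathCell.symm z.2.2⟩ : Σ a b, cell n m (Nat.le_of_succ_le_succ h)
            (pathHom A a b))) h₃
      exact (congrArg (fun z => (⟨a, b, z⟩ : Σ a b, cell n m (Nat.le_of_succ_le_succ h)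
        (pathHom A a b))) (Equiv.symm_apply_apply pathCell x)).symm.trans (h₄.trans
          (congrArg (fun z => (⟨c, d, z⟩ : Σ a b, cell n m (Nat.le_of_succ_le_succ h)
            (pathHom A a b))) (Equiv.symm_apply_apply pathCell y)))
    · intro y
      cases y with
      | low h x => exact absurd h (Nat.not_succ_le_zero _)
      | str h' k w =>
        obtain ⟨a, b, p, ha, hp⟩ := EdgePath.exists_toList_eq
          (H := fun a b => cell n m (Nat.le_of_succ_le_succ h) (VGraph.edge A a b)) k w.vertex
          w.arrow (fun j => (srcTo_zero_consCell A _ _ (w.arrow j).2.2).symm.trans (w.src_arrow j))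
          (fun j => (tgtTo_zero_consCell A _ _ (w.arrow j).2.2).symm.trans (w.tgt_arrow j))
        refine ⟨⟨a, b, pathCell.symm p⟩, GSet.FreeCell.str_ext ?_ ?_⟩
        · exact (EdgePath.vertex_zero _).trans ha
        · refine (EdgePath.ofFn_arrow _).trans (Eq.trans ?_ hp)
          exact congrArg EdgePath.toList (Equiv.apply_symm_apply _ p)

/-- In dimension one the source is the first vertex of the path, in higher dimensions it is formed
edge by edge; these are the two cases in the definition of the source of a string. -/
theorem freeCell_src (A : NGph.{u} (n + 1)) (m : ℕ) (h : m + 1 ≤ n + 1)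
    (x : cell (n + 1) (m + 1) h
      ((forget (NGph.{u} n)).obj ((freeFunctor n).obj A) : VGraph (NGph.{u} n))) :
    freeCell A m (Nat.le_of_succ_le h) (src (n + 1) m h _ x) = (freeCell A (m + 1) h x).s := by
  obtain ⟨a, b, x⟩ := x
  cases m with
  | zero => exact congrArg (GSet.FreeCell.low le_rfl) (EdgePath.vertex_zero _).symm
  | succ m =>
    refine Eq.trans (GSet.FreeCell.str_ext ?_ ?_) (GSet.FreeCell.s_str (Nat.succ_pos m) _ _).symm
    · exact (EdgePath.vertex_zero _).trans (EdgePath.vertex_zero _).symm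
    · refine (EdgePath.ofFn_arrow _).trans ((congrArg EdgePath.toList (pathCell_src x)).trans
        ((EdgePath.toList_map _ _ _).trans ?_))
      exact (congrArg (List.map _) (EdgePath.ofFn_arrow _).symm).trans List.map_ofFn

theorem freeCell_tgt (A : NGph.{u} (n + 1)) (m : ℕ) (h : m + 1 ≤ n + 1)
    (x : cell (n + 1) (m + 1) h
      ((forget (NGph.{u} n)).obj ((freeFunctor n).obj A) : VGraph (NGph.{u} n))) :
    freeCell A m (Nat.le_of_succ_le h) (tgt (n + 1) m h _ x) = (freeCell A (m + 1) h x).t := by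
  obtain ⟨a, b, x⟩ := x
  cases m with
  | zero => exact congrArg (GSet.FreeCell.low le_rfl) (EdgePath.vertex_last _).symm
  | succ m =>
    refine Eq.trans (GSet.FreeCell.str_ext ?_ ?_) (GSet.FreeCell.t_str (Nat.succ_pos m) _ _).symm
    · exact (EdgePath.vertex_zero _).trans (EdgePath.vertex_zero _).symm
    · refine (EdgePath.ofFn_arrow _).trans ((congrArg EdgePath.toList (pathCell_tgt x)).trans
        ((EdgePath.toList_map _ _ _).trans ?_))
      exact (congrArg (List.map _) (EdgePath.ofFn_arrow _).symm).trans List.map_ofFn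

theorem pathCell_map_freeFunctor {A B : VGraph.{u} (NGph.{u} n)} (f : A ⟶ B) {a b : A.Obj}
    (x : cell n m h (pathHom A a b)) :
    pathCell (A := B) (mapCell n m h ((toGraphHom (freeLift (f ≫ freeUnit B))).map a b) x) =
      (pathCell x).map (H' := fun a b => cell n m h (B.edge a b)) (VGraph.Hom.obj f)
        (fun _ _ => mapCell n m h (VGraph.Hom.map f _ _)) :=
  (congrArg (pathCell (A := B)) (mapCell_freeLift (f ≫ freeUnit B) x)).trans
    (pathCell_fold_comp_freeUnit f _)

/-- The monad of the free category adjunction, on `(n+1)`-graphs. -/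
noncomputable def freeGph (n : ℕ) : NGph.{u} (n + 1) ⥤ NGph.{u} (n + 1) :=
  freeFunctor.{u} n ⋙ forget (NGph.{u} n)

/-- The unit of the free category adjunction, on `(n+1)`-graphs. -/
noncomputable def freeGphUnit (n : ℕ) : 𝟭 (NGph.{u} (n + 1)) ⟶ freeGph.{u} n :=
  (freeAdj n).unit

theorem freeCell_map {A B : NGph.{u} (n + 1)} (f : A ⟶ B) (m : ℕ) (h : m ≤ n + 1)
    (x : cell (n + 1) m h ((freeGph n).obj A)) :
    freeCell B m h (mapCell (n + 1) m h ((freeGph n).map f) x) =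
      (freeCell A m h x).map ((toGSet (n + 1)).map f) := by
  -- With this form of the functor, its action on a path is the image of the path edge by edge.
  have hf : (freeGph n).map f = (forget (NGph.{u} n)).map (freeLift (toHom f ≫ freeUnit B)) :=
    congrArg (forget (NGph.{u} n)).map (freeFunctor_map (toHom f))
  rw [hf]
  cases m with
  | zero => rfl
  | succ m =>
    obtain ⟨a, b, x⟩ := x
    refine GSet.FreeCell.str_ext ?_ ?_
    · exact (EdgePath.vertex_zero _).trans
        (congrArg (VGraph.Hom.obj (toHom f)) (EdgePath.vertex_zero _)).symm
    · refine (EdgePath.ofFn_arrow _).trans ((congrArg EdgePath.toList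
        (pathCell_map_freeFunctor (toHom f) x)).trans ((EdgePath.toList_map _ _ _).trans ?_))
      exact (congrArg (List.map _) (EdgePath.ofFn_arrow _).symm).trans List.map_ofFn

theorem freeCell_unit (A : NGph.{u} (n + 1)) (m : ℕ) (h : m ≤ n + 1) (x : cell (n + 1) m h A) :
    freeCell A m h (mapCell (n + 1) m h ((freeGphUnit n).app A) x) =
      GSet.FreeCell.single (X := (toGSet (n + 1)).obj A) x := by
  have hf : (freeGphUnit n).app A = freeUnit A := freeAdj_unit A
  rw [hf]
  cases m with
  | zero => rfl
  | succ m =>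
    obtain ⟨a, b, x⟩ := x
    refine Eq.trans (GSet.FreeCell.str_ext ?_ ?_)
      (GSet.FreeCell.single_of_lt (Nat.succ_pos m) _).symm
    · exact (EdgePath.vertex_zero _).trans (srcTo_zero_consCell A a b x).symm
    · exact (EdgePath.ofFn_arrow _).trans (congrArg EdgePath.toList (pathCell_freeUnit A x))

/-- The cells of the free category on a graph are the strings of cells. -/
theorem exists_iso_freeStr (n : ℕ) :
    ∃ φ : freeGph.{u} n ⋙ toGSet.{u} (n + 1) ≅
        toGSet.{u} (n + 1) ⋙ GSet.freeStr.{u} (n + 1) 0 (Nat.zero_le _),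
      ∀ A : NGph.{u} (n + 1), (toGSet.{u} (n + 1)).map ((freeGphUnit n).app A) ≫ φ.hom.app A =
        (GSet.singleStr.{u} (n + 1) 0 (Nat.zero_le _)).app ((toGSet.{u} (n + 1)).obj A) :=
  NGph.exists_iso_freeStr (Nat.zero_le _) _ (freeGphUnit n) freeCell freeCell_bijective
    freeCell_src freeCell_tgt freeCell_map freeCell_unit

end VCat

/-! ### The dimension shift from `A(a, b)` to `A` -/

namespace NGph

variable {n : ℕ}

section

variable (A : NGph.{u} (n + 1)) (a b : VGraph.Obj A)

/-- The globular set of an `n`-graph `A(a, b)`. -/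
abbrev edgeGSet : GSet.{u} n := (toGSet n).obj (VGraph.edge (V := NGph.{u} n) A a b)

/-- Sources in `A` that stay in positive dimension are computed inside `A(a, b)`, one dimension
lower. -/
theorem srcTo_consCell (i : ℕ) (hi : i ≤ n) (m : ℕ) (hm : m ≤ n) (h : i ≤ m)
    (x : (edgeGSet A a b).cell m hm) :
    ((toGSet (n + 1)).obj A).srcTo (i + 1) (Nat.succ_le_succ hi) (m + 1) (Nat.succ_le_succ hm)
      (Nat.succ_le_succ h) (consCell A a b x) =
        consCell A a b ((edgeGSet A a b).srcTo i hi m hm h x) := by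
  induction m, h using Nat.le_induction with
  | base =>
    exact (GSet.srcTo_self _ _ _ _).trans
      (congrArg (consCell A a b) (GSet.srcTo_self _ _ _ _).symm)
  | succ m h ih =>
    refine (GSet.srcTo_succ _ _ _ (m + 1) _ (Nat.succ_le_succ h) _).trans
      ((ih (Nat.le_of_succ_le hm) (src n m hm _ x)).trans ?_)
    exact congrArg (consCell A a b) (GSet.srcTo_succ _ _ _ m hm h x).symm

theorem tgtTo_consCell (i : ℕ) (hi : i ≤ n) (m : ℕ) (hm : m ≤ n) (h : i ≤ m)
    (x : (edgeGSet A a b).cell m hm) :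
    ((toGSet (n + 1)).obj A).tgtTo (i + 1) (Nat.succ_le_succ hi) (m + 1) (Nat.succ_le_succ hm)
      (Nat.succ_le_succ h) (consCell A a b x) =
        consCell A a b ((edgeGSet A a b).tgtTo i hi m hm h x) := by
  induction m, h using Nat.le_induction with
  | base =>
    exact (GSet.tgtTo_self _ _ _ _).trans
      (congrArg (consCell A a b) (GSet.tgtTo_self _ _ _ _).symm)
  | succ m h ih =>
    refine (GSet.tgtTo_succ _ _ _ (m + 1) _ (Nat.succ_le_succ h) _).trans
      ((ih (Nat.le_of_succ_le hm) (tgt n m hm _ x)).trans ?_)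
    exact congrArg (consCell A a b) (GSet.tgtTo_succ _ _ _ m hm h x).symm

variable {A a b} {i : ℕ} {hi : i ≤ n} {m : ℕ}

/-- A string of cells of `A(a, b)` as a string of cells of `A`. -/
def consStr {hm : m ≤ n} {h : i < m} {k : ℕ} (w : (edgeGSet A a b).Str i hi m hm h k) :
    ((toGSet (n + 1)).obj A).Str (i + 1) (Nat.succ_le_succ hi) (m + 1) (Nat.succ_le_succ hm)
      (Nat.succ_lt_succ h) k where
  vertex j := consCell A a b (w.vertex j)
  arrow j := consCell A a b (w.arrow j)
  src_arrow j := (srcTo_consCell A a b i hi m hm h.le _).trans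
    (congrArg (consCell A a b) (w.src_arrow j))
  tgt_arrow j := (tgtTo_consCell A a b i hi m hm h.le _).trans
    (congrArg (consCell A a b) (w.tgt_arrow j))

/-- A cell of the free composition on `A(a, b)` as a cell of the free composition on `A`. -/
def consFree {hm : m ≤ n} : (edgeGSet A a b).FreeCell i hi m hm →
    ((toGSet (n + 1)).obj A).FreeCell (i + 1) (Nat.succ_le_succ hi) (m + 1) (Nat.succ_le_succ hm)
  | .low h x => .low (Nat.succ_le_succ h) (consCell A a b x)
  | .str h k w => .str (Nat.succ_lt_succ h) k (consStr w)

/-- The shift raises both `i` and `m` by one, so both sides fall under the same case of the source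
of a string. -/
theorem consFree_s {hm : m + 1 ≤ n} (c : (edgeGSet A a b).FreeCell i hi (m + 1) hm) :
    consFree c.s = (consFree c).s := by
  cases c with
  | low h x => rfl
  | str h k w =>
    rcases lt_or_eq_of_le (Nat.le_of_lt_succ h) with h' | rfl
    · exact (congrArg consFree (GSet.FreeCell.s_str h' k w)).trans
        (GSet.FreeCell.s_str (Nat.succ_lt_succ h') k (consStr w)).symm
    · exact (congrArg consFree (GSet.FreeCell.s_str_self k w)).trans
        (GSet.FreeCell.s_str_self k (consStr w)).symm

theorem consFree_t {hm : m + 1 ≤ n} (c : (edgeGSet A a b).FreeCell i hi (m + 1) hm) :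
    consFree c.t = (consFree c).t := by
  cases c with
  | low h x => rfl
  | str h k w =>
    rcases lt_or_eq_of_le (Nat.le_of_lt_succ h) with h' | rfl
    · exact (congrArg consFree (GSet.FreeCell.t_str h' k w)).trans
        (GSet.FreeCell.t_str (Nat.succ_lt_succ h') k (consStr w)).symm
    · exact (congrArg consFree (GSet.FreeCell.t_str_self k w)).trans
        (GSet.FreeCell.t_str_self k (consStr w)).symm

theorem consFree_single {hm : m ≤ n} (x : (edgeGSet A a b).cell m hm) :
    consFree (GSet.FreeCell.single x : (edgeGSet A a b).FreeCell i hi m hm) =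
      GSet.FreeCell.single (X := (toGSet (n + 1)).obj A) (m := m + 1)
        (hm := Nat.succ_le_succ hm) (consCell A a b x) := by
  rcases lt_or_ge i m with h | h
  · have hw : consStr (hi := hi) (GSet.Str.single h x) = GSet.Str.single
        (X := (toGSet (n + 1)).obj A) (hm := Nat.succ_le_succ hm) (Nat.succ_lt_succ h)
        (consCell A a b x) := by
      refine GSet.Str.ext (funext fun j => ?_) rfl
      fin_cases j
      · exact (srcTo_consCell A a b i hi m hm h.le x).symm
      · exact (tgtTo_consCell A a b i hi m hm h.le x).symm
    exact (congrArg consFree (GSet.FreeCell.single_of_lt h x)).trans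
      ((congrArg (GSet.FreeCell.str _ 1) hw).trans
        (GSet.FreeCell.single_of_lt (Nat.succ_lt_succ h) _).symm)
  · exact (congrArg consFree (GSet.FreeCell.single_of_le h x)).trans
      (GSet.FreeCell.single_of_le (Nat.succ_le_succ h) _).symm

theorem consFree_map {A B : NGph.{u} (n + 1)} (f : A ⟶ B) {a b : VGraph.Obj A} {hm : m ≤ n}
    (c : (edgeGSet A a b).FreeCell i hi m hm) :
    consFree (A := B) (c.map ((toGSet n).map ((toHom f).map a b))) =
      (consFree c).map ((toGSet (n + 1)).map f) := by
  cases c <;> rfl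

/-- Parallel cells of positive dimension lie in the same `A(a, b)`: for 1-cells the source and
target are the endpoints, and above that the source already records them. -/
theorem fst_eq_of_src_eq {A : NGph.{u} (n + 1)} : ∀ {m : ℕ} {h : m + 1 ≤ n + 1}
    {x y : cell (n + 1) (m + 1) h A} (_ : src (n + 1) m h A x = src (n + 1) m h A y)
    (_ : tgt (n + 1) m h A x = tgt (n + 1) m h A y), x.1 = y.1 ∧ x.2.1 = y.2.1
  | 0, _, _, _, h₁, h₂ => ⟨h₁, h₂⟩
  | _ + 1, _, _, _, h₁, _ => ⟨(Sigma.mk.inj h₁).1, congrArg (fun z => z.2.1) h₁⟩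

theorem exists_eq_consCell {A : NGph.{u} (n + 1)} {m : ℕ} {h : m + 1 ≤ n + 1} {a b : VGraph.Obj A}
    (x : cell (n + 1) (m + 1) h A) (h₁ : x.1 = a) (h₂ : x.2.1 = b) :
    ∃ y : (edgeGSet A a b).cell m (Nat.le_of_succ_le_succ h), x = consCell A a b y := by
  obtain ⟨c, d, y⟩ := x
  subst h₁ h₂
  exact ⟨y, rfl⟩

/-- The strings of cells in `A` are the strings of cells in the `A(a, b)`. -/
theorem consFree_bijective {A : NGph.{u} (n + 1)} {hm : m ≤ n} :
    Function.Bijective (fun x : Σ a b, (edgeGSet A a b).FreeCell i hi m hm => consFree x.2.2) := by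
  constructor
  · rintro ⟨a, b, x⟩ ⟨c, d, y⟩ hxy
    cases x with
    | low h x =>
      cases y with
      | low h' y =>
        replace hxy := GSet.FreeCell.low.inj hxy
        obtain ⟨rfl, hxy⟩ := Sigma.mk.inj hxy
        obtain ⟨rfl, hxy⟩ := Sigma.mk.inj (eq_of_heq hxy)
        cases hxy
        rfl
      | str h' k w => exact absurd h' (Nat.not_lt.2 h)
    | str h k w =>
      cases y with
      | low h' y => exact absurd h (Nat.not_lt.2 h')
      | str h' k' w' =>
        obtain ⟨rfl, hxy⟩ := GSet.FreeCell.str.inj hxy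
        replace hxy := eq_of_heq hxy
        have hv := congrArg GSet.Str.vertex hxy
        have ha := congrArg GSet.Str.arrow hxy
        -- The endpoints are read off the first vertex, since a string of length zero has no arrow.
        obtain ⟨rfl, h₁⟩ := Sigma.mk.inj (congrFun hv 0)
        obtain ⟨rfl, -⟩ := Sigma.mk.inj (eq_of_heq h₁)
        have hw : w = w' := GSet.Str.ext
          (funext fun j => consCell_injective A a b (congrFun hv j))
          (funext fun j => consCell_injective A a b (congrFun ha j))
        rw [hw]
  · intro y
    cases y with
    | low h x =>
      obtain ⟨a, b, x⟩ := x
      exact ⟨⟨a, b, .low (Nat.le_of_succ_le_succ h) x⟩, rfl⟩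
    | str h k w =>
      have h' : i < m := Nat.lt_of_succ_lt_succ h
      -- The vertices have positive dimension `i + 1` and are all parallel to the first, so they lie
      -- in one `A(a, b)`.
      obtain ⟨a, b, hv⟩ : ∃ a b, ∀ j, (w.vertex j).1 = a ∧ (w.vertex j).2.1 = b :=
        ⟨_, _, fun j => fst_eq_of_src_eq (w.s_vertex j) (w.t_vertex j)⟩
      -- An arrow has the same endpoints as its iterated source, which is a vertex.
      have ha : ∀ j, (w.arrow j).1 = a ∧ (w.arrow j).2.1 = b := fun j => by
        have h₁ := (srcTo_consCell A _ _ i hi m hm h'.le (w.arrow j).2.2).symm.trans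
          (w.src_arrow j)
        have h₂ := hv j.castSucc
        rw [← h₁] at h₂
        exact h₂
      choose v hv using fun j =>
        exists_eq_consCell (h := Nat.succ_le_succ hi) (w.vertex j) (hv j).1 (hv j).2
      choose e he using fun j =>
        exists_eq_consCell (h := Nat.succ_le_succ hm) (w.arrow j) (ha j).1 (ha j).2
      have h₁ : ∀ j, (edgeGSet A a b).srcTo i hi m hm h'.le (e j) = v j.castSucc := fun j => by
        apply consCell_injective A a b
        refine (srcTo_consCell A a b i hi m hm h'.le (e j)).symm.trans ?_
        exact (congrArg _ (he j).symm).trans ((w.src_arrow j).trans (hv j.castSucc))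
      have h₂ : ∀ j, (edgeGSet A a b).tgtTo i hi m hm h'.le (e j) = v j.succ := fun j => by
        apply consCell_injective A a b
        refine (tgtTo_consCell A a b i hi m hm h'.le (e j)).symm.trans ?_
        exact (congrArg _ (he j).symm).trans ((w.tgt_arrow j).trans (hv j.succ))
      let w' : (edgeGSet A a b).Str i hi m hm h' k := ⟨v, e, h₁, h₂⟩
      have hw : consStr w' = w :=
        GSet.Str.ext (funext fun j => (hv j).symm) (funext fun j => (he j).symm)
      exact ⟨⟨a, b, .str h' k w'⟩, congrArg (GSet.FreeCell.str h k) hw⟩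

end

/-- The functor that applies `T` to the `n`-graphs `A(a, b)`. -/
def mapEdges (T : NGph.{u} n ⥤ NGph.{u} n) : NGph.{u} (n + 1) ⥤ NGph.{u} (n + 1) :=
  VGraph.pushforward (V := NGph.{u} n) (W := NGph.{u} n) T

/-- The natural transformation that applies `η` to the `n`-graphs `A(a, b)`. -/
def mapEdgesUnit {T : NGph.{u} n ⥤ NGph.{u} n} (η : 𝟭 _ ⟶ T) : 𝟭 _ ⟶ mapEdges T where
  app A := VGraph.Hom.mk (V := NGph.{u} n) (A := A) (B := (mapEdges T).obj A) (fun a => a)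
    (fun a b => η.app (VGraph.edge A a b))
  naturality A B f := VGraph.hom_mk_congr (V := NGph.{u} n) (A := A) (B := (mapEdges T).obj B)
    fun a b =>
    η.naturality ((toHom f).map a b)

section

variable {i : ℕ} {hi : i ≤ n} {T : NGph.{u} n ⥤ NGph.{u} n}
  (φ : T ⋙ toGSet.{u} n ≅ toGSet.{u} n ⋙ GSet.freeStr.{u} n i hi)

/-- The cells of `T A(a, b)` as strings of cells of `A(a, b)`. -/
def isoCell (A : NGph.{u} n) (m : ℕ) (h : m ≤ n) :
    cell n m h (T.obj A) → ((toGSet n).obj A).FreeCell i hi m h :=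
  GSet.Hom.app (φ.hom.app A) m h

/-- The cells of `mapEdges T` as strings of cells. -/
def edgeCell (A : NGph.{u} (n + 1)) : ∀ (m : ℕ) (h : m ≤ n + 1),
    cell (n + 1) m h ((mapEdges T).obj A) →
      ((toGSet (n + 1)).obj A).FreeCell (i + 1) (Nat.succ_le_succ hi) m h
  | 0, h, x => .low (Nat.zero_le _) (show ((toGSet (n + 1)).obj A).cell 0 h from x)
  | m + 1, h, x => consFree (A := A) (a := x.1) (b := x.2.1)
      (isoCell φ (VGraph.edge A x.1 x.2.1) m (Nat.le_of_succ_le_succ h) x.2.2)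

theorem isoCell_bijective (A : NGph.{u} n) (m : ℕ) (h : m ≤ n) :
    Function.Bijective (isoCell φ A m h) :=
  GSet.app_bijective (φ.app A) m h

theorem edgeCell_bijective (A : NGph.{u} (n + 1)) (m : ℕ) (h : m ≤ n + 1) :
    Function.Bijective (edgeCell φ A m h) := by
  cases m with
  | zero =>
    refine ⟨fun x y hxy => GSet.FreeCell.low.inj hxy, fun y => ?_⟩
    cases y with
    | low h x => exact ⟨x, rfl⟩
    | str h k w => exact absurd h (Nat.not_lt_zero _)
  | succ m =>
    let g : cell (n + 1) (m + 1) h ((mapEdges T).obj A) →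
        Σ a b, (edgeGSet A a b).FreeCell i hi m (Nat.le_of_succ_le_succ h) :=
      fun x => ⟨x.1, x.2.1, isoCell φ (VGraph.edge A x.1 x.2.1) m (Nat.le_of_succ_le_succ h) x.2.2⟩
    -- The cells are identified edgewise by `φ`, and the resulting family over all pairs of objects
    -- is collected by `consFree_bijective`.
    refine Function.Bijective.comp (f := g) consFree_bijective ⟨?_, ?_⟩
    · rintro ⟨a, b, x⟩ ⟨c, d, y⟩ hxy
      obtain ⟨rfl, hxy⟩ := Sigma.mk.inj hxy
      obtain ⟨rfl, hxy⟩ := Sigma.mk.inj (eq_of_heq hxy)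
      exact congrArg (consCell ((mapEdges T).obj A) a b)
        ((isoCell_bijective φ _ _ _).1 (eq_of_heq hxy))
    · rintro ⟨a, b, y⟩
      obtain ⟨x, rfl⟩ := (isoCell_bijective φ _ _ _).2 y
      exact ⟨⟨a, b, x⟩, rfl⟩

theorem edgeCell_src (A : NGph.{u} (n + 1)) (m : ℕ) (h : m + 1 ≤ n + 1)
    (x : cell (n + 1) (m + 1) h ((mapEdges T).obj A)) :
    edgeCell φ A m (Nat.le_of_succ_le h) (src (n + 1) m h _ x) =
      (edgeCell φ A (m + 1) h x).s := by
  obtain ⟨a, b, x⟩ := x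
  cases m with
  | zero =>
    -- A 1-cell of `A` is a 0-cell of `A(a, b)`, which cannot be a string because `i < 0` is
    -- impossible.
    change _ = (consFree (isoCell φ _ 0 _ x)).s
    generalize isoCell φ _ 0 _ x = y
    cases y with
    | low h x => rfl
    | str h k w => exact absurd h (Nat.not_lt_zero _)
  | succ m =>
    exact (congrArg consFree (GSet.Hom.app_s (φ.hom.app (VGraph.edge A a b)) m
      (Nat.le_of_succ_le_succ h) x)).trans (consFree_s _)

theorem edgeCell_tgt (A : NGph.{u} (n + 1)) (m : ℕ) (h : m + 1 ≤ n + 1)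
    (x : cell (n + 1) (m + 1) h ((mapEdges T).obj A)) :
    edgeCell φ A m (Nat.le_of_succ_le h) (tgt (n + 1) m h _ x) =
      (edgeCell φ A (m + 1) h x).t := by
  obtain ⟨a, b, x⟩ := x
  cases m with
  | zero =>
    change _ = (consFree (isoCell φ _ 0 _ x)).t
    generalize isoCell φ _ 0 _ x = y
    cases y with
    | low h x => rfl
    | str h k w => exact absurd h (Nat.not_lt_zero _)
  | succ m =>
    exact (congrArg consFree (GSet.Hom.app_t (φ.hom.app (VGraph.edge A a b)) m
      (Nat.le_of_succ_le_succ h) x)).trans (consFree_t _)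

theorem edgeCell_map {A B : NGph.{u} (n + 1)} (f : A ⟶ B) (m : ℕ) (h : m ≤ n + 1)
    (x : cell (n + 1) m h ((mapEdges T).obj A)) :
    edgeCell φ B m h (mapCell (n + 1) m h ((mapEdges T).map f) x) =
      (edgeCell φ A m h x).map ((toGSet (n + 1)).map f) := by
  cases m with
  | zero => rfl
  | succ m =>
    obtain ⟨a, b, x⟩ := x
    exact (congrArg (consFree (A := B)) (congrFun (congrFun (congrFun (congrArg GSet.Hom.app
      (φ.hom.naturality ((toHom f).map a b))) m) (Nat.le_of_succ_le_succ h)) x)).trans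
        (consFree_map f _)

/-- If the cells of `T A` are the `i`-dimensional strings of cells of `A`, then the cells of
`mapEdges T A` are the `(i+1)`-dimensional strings of cells of `A`. -/
theorem exists_iso_freeStr_mapEdges (η : 𝟭 _ ⟶ T)
    (hη : ∀ A : NGph.{u} n, (toGSet.{u} n).map (η.app A) ≫ φ.hom.app A =
        (GSet.singleStr.{u} n i hi).app ((toGSet.{u} n).obj A)) :
    ∃ φ : mapEdges T ⋙ toGSet.{u} (n + 1) ≅
        toGSet.{u} (n + 1) ⋙ GSet.freeStr.{u} (n + 1) (i + 1) (Nat.succ_le_succ hi),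
      ∀ A : NGph.{u} (n + 1), (toGSet.{u} (n + 1)).map ((mapEdgesUnit η).app A) ≫ φ.hom.app A =
        (GSet.singleStr.{u} (n + 1) (i + 1) (Nat.succ_le_succ hi)).app
          ((toGSet.{u} (n + 1)).obj A) :=
  exists_iso_freeStr (Nat.succ_le_succ hi) _ (mapEdgesUnit η) (edgeCell φ) (edgeCell_bijective φ)
    (edgeCell_src φ) (edgeCell_tgt φ) (edgeCell_map φ) (fun A m h x => by
      cases m with
      | zero =>
        exact (GSet.FreeCell.single_of_le (X := (toGSet (n + 1)).obj A) (hm := h)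
          (Nat.zero_le _) x).symm
      | succ m =>
        obtain ⟨a, b, x⟩ := x
        exact (congrArg consFree (congrFun (congrFun (congrFun (congrArg GSet.Hom.app
          (hη (VGraph.edge A a b))) m) (Nat.le_of_succ_le_succ h)) x)).trans (consFree_single x))

end

/-! ### The induction on `n` and `i` -/

/-- The forgetful functor is monadic, and the cells of its monad are strings of cells. -/
theorem exists_monadic_adjunction : ∀ (n i : ℕ) (hi : i < n),
    ∃ (F : NGph.{u} n ⥤ CatGph.{u} n i hi) (adj : F ⊣ CatGph.forget.{u} n i hi),
      (Monad.comparison adj).IsEquivalence ∧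
      ∃ φ : (F ⋙ CatGph.forget.{u} n i hi) ⋙ toGSet.{u} n ≅
          toGSet.{u} n ⋙ GSet.freeStr.{u} n i hi.le,
        ∀ A : NGph.{u} n, (toGSet.{u} n).map (adj.unit.app A) ≫ φ.hom.app A =
          (GSet.singleStr.{u} n i hi.le).app ((toGSet.{u} n).obj A)
  | 0, _, h => absurd h (Nat.not_lt_zero _)
  | n + 1, 0, _ => ⟨VCat.freeFunctor.{u} n, VCat.freeAdj.{u} n,
      VCat.freeAdj_comparison_isEquivalence.{u} n, VCat.exists_iso_freeStr.{u} n⟩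
  | n + 1, i + 1, h => by
    -- The forgetful functor for `(n + 1, i + 1)` is by definition the one for `(n, i)` applied
    -- edgewise, so the adjunction, its monadicity and the description of cells all carry over.
    obtain ⟨F, adj, hadj, φ, hφ⟩ := exists_monadic_adjunction n i (Nat.lt_of_succ_lt_succ h)
    exact ⟨VGraph.pushforward (V := NGph.{u} n) (W := CatGph.{u} n i _) F,
      VGraph.pushforwardAdj (C := NGph.{u} n) (D := CatGph.{u} n i _) adj,
      VGraph.pushforwardAdj_comparison_isEquivalence (C := NGph.{u} n) (D := CatGph.{u} n i _)
        adj hadj,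
      exists_iso_freeStr_mapEdges φ adj.unit hφ⟩

end NGph

theorem mainTheorem4 (n i : ℕ) (hi : i < n) :
    (NGph.toGSet.{u} n).IsEquivalence ∧
    ∃ (F : NGph.{u} n ⥤ CatGph.{u} n i hi) (adj : F ⊣ CatGph.forget.{u} n i hi),
      (Monad.comparison adj).IsEquivalence ∧
      ∃ φ : adj.toMonad.toFunctor ⋙ NGph.toGSet.{u} n ≅
          NGph.toGSet.{u} n ⋙ GSet.freeStr.{u} n i hi.le,
        ∀ A : NGph.{u} n,
          (NGph.toGSet.{u} n).map (adj.toMonad.η.app A) ≫ φ.hom.app A =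
            (GSet.singleStr.{u} n i hi.le).app ((NGph.toGSet.{u} n).obj A) :=
  -- The underlying functor and the unit of `adj.toMonad` are definitionally the composite of the
  -- adjoints and the unit of `adj`.
  ⟨NGph.toGSet_isEquivalence n, NGph.exists_monadic_adjunction n i hi⟩
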